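/- All functions are real-valued on $\mathbb R^3$. Let $\kappa>0$, $-\infty<\xi\le 0$, $C_g=\pi^{-3/4}$, let $\ln_{+,\xi}(s)=\max(\ln s,\xi)$ for $s>0$ and $\ln_{+,\xi}(0)=\xi$, and put $$G'_{\kappa,\xi}(s)=-\kappa^2\ln_{+,\xi}\!\big(\kappa^{-3}s/C_g^2\big)-3\kappa^2,\qquad G_{\kappa,\xi}(s)=\int_0^s G'_{\kappa,\xi}(t)\,dt,\qquad g_{\kappa,\xi}(\psi)=G'_{\kappa,\xi}(|\psi|^2)\,\psi .$$ Let $H^1_{\mathrm{rad}}(\mathbb R^3)$ be the space of those $\Psi\in H^1(\mathbb R^3)$ that depend only on $|x|$, let $\Xi_{\mathrm{rad}}=\{\Psi\in H^1_{\mathrm{rad}}(\mathbb R^3):\int|\Psi|^2\,dx=1\}$, and for $\Psi\in H^1(\mathbb R^3)$ let $$\mathcal E_{\kappa,\xi}(\Psi)=\int_{\mathbb R^3}\Big(\tfrac12|\nabla\Psi|^2-\tfrac1{|x|}|\Psi|^2\Big)dx+\tfrac12\int_{\mathbb R^3}G_{\kappa,\xi}(|\Psi|^2)\,dx .$$ Let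 $\beta>0$ and assume that $\kappa$ is small relative to $\beta$ in the sense that $\kappa^2(\xi+3)<2\beta$ (this holds automatically if $\xi\le-3$). Theorem. Let $\Psi_j\in\Xi_{\mathrm{rad}}$ be a sequence with $\mathcal E_{\kappa,\xi}(\Psi_j)\le-\beta$ for all $j$, and let $\omega_j\in\mathbb R$ be such that $$F\Psi_j=\omega_j\Psi_j+\tfrac12\nabla^2\Psi_j+\tfrac1{|x|}\Psi_j-\tfrac12\,g_{\kappa,\xi}(\Psi_j)\;\longrightarrow\;0\quad\text{strongly in }H^{-1}(\mathbb R^3),$$ where $H^{-1}(\mathbb R^3)$ is the dual of $H^1(\mathbb R^3)$. Then $(\Psi_j)$ has a subsequence that converges strongly in $H^1_{\mathrm{rad}}(\mathbb R^3)$. -/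

import Mathlib

open MeasureTheory Filter Topology

open scoped ENNReal

noncomputable section

namespace CoulombLog

/-- Euclidean three-space. -/
abbrev R3 : Type := EuclideanSpace ℝ (Fin 3)

/-- Real test functions: smooth with compact support. -/
def IsTest (φ : R3 → ℝ) : Prop := ContDiff ℝ ((⊤ : ℕ∞) : WithTop ℕ∞) φ ∧ HasCompactSupport φ

/-- The `i`-th partial derivative of a (smooth) function. -/
def partialDeriv (i : Fin 3) (φ : R3 → ℝ) (x : R3) : ℝ :=
  fderiv ℝ φ x (EuclideanSpace.single i 1)

/-- `w` is the weak (distributional) gradient of `u`. -/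
def IsWeakGradient (u : R3 → ℝ) (w : R3 → R3) : Prop :=
  ∀ φ : R3 → ℝ, IsTest φ → ∀ i : Fin 3,
    ∫ x, u x * partialDeriv i φ x = -∫ x, w x i * φ x

theorem IsTest.memLp {φ : R3 → ℝ} (h : IsTest φ) : MemLp φ 2 volume :=
  h.1.continuous.memLp_of_hasCompactSupport h.2

theorem IsTest.memLp_partialDeriv {φ : R3 → ℝ} (h : IsTest φ) (i : Fin 3) :
    MemLp (partialDeriv i φ) 2 volume := by
  have hc : Continuous (fderiv ℝ φ) := h.1.continuous_fderiv (by simp)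
  have hs : HasCompactSupport (fderiv ℝ φ) := h.2.fderiv ℝ
  have hc' : Continuous (partialDeriv i φ) := hc.clm_apply continuous_const
  refine hc'.memLp_of_hasCompactSupport (hs.mono ?_)
  intro x hx hx'
  apply hx
  simp [partialDeriv, hx']

theorem memLp_coord {w : R3 → R3} (hw : MemLp w 2 volume) (i : Fin 3) :
    MemLp (fun x => w x i) 2 volume :=
  (EuclideanSpace.proj i : R3 →L[ℝ] ℝ).comp_memLp' hw

/-- The real Sobolev space `H¹(ℝ³)`: the pairs `(u, ∇u)` with `u ∈ L²` and weak gradient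
`∇u ∈ L²`, with the Hilbert norm `‖u‖² + ‖∇u‖²`. -/
def H1 : Submodule ℝ (WithLp 2 (Lp ℝ 2 (volume : Measure R3) × Lp R3 2 (volume : Measure R3))) where
  carrier := {p | IsWeakGradient p.fst p.snd}
  zero_mem' := by
    intro φ _ i
    have h1 : ∫ x, ((0 : Lp ℝ 2 (volume : Measure R3)) x) * partialDeriv i φ x = 0 := by
      refine integral_eq_zero_of_ae ?_
      filter_upwards [Lp.coeFn_zero ℝ 2 (volume : Measure R3)] with x hx
      rw [hx]
      simp
    have h2 : ∫ x, ((0 : Lp R3 2 (volume : Measure R3)) x) i * φ x = 0 := by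
      refine integral_eq_zero_of_ae ?_
      filter_upwards [Lp.coeFn_zero R3 2 (volume : Measure R3)] with x hx
      rw [hx]
      simp
    exact h1.trans (by rw [← neg_zero, ← h2]; rfl)
  add_mem' := by
    intro p q hp hq φ hφ i
    have h1 : ∫ x, (p.fst + q.fst) x * partialDeriv i φ x =
        ∫ x, (p.fst x * partialDeriv i φ x + q.fst x * partialDeriv i φ x) := by
      refine integral_congr_ae ?_
      filter_upwards [Lp.coeFn_add p.fst q.fst] with x hx
      rw [hx]
      simp [add_mul]
    have h2 : ∫ x, (p.snd + q.snd) x i * φ x =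
        ∫ x, (p.snd x i * φ x + q.snd x i * φ x) := by
      refine integral_congr_ae ?_
      filter_upwards [Lp.coeFn_add p.snd q.snd] with x hx
      rw [hx]
      simp [add_mul]
    have hd := hφ.memLp_partialDeriv i
    have h3 := integral_add ((Lp.memLp p.fst).integrable_mul hd)
      ((Lp.memLp q.fst).integrable_mul hd)
    have h4 := integral_add ((memLp_coord (Lp.memLp p.snd) i).integrable_mul hφ.memLp)
      ((memLp_coord (Lp.memLp q.snd) i).integrable_mul hφ.memLp)
    simp only [Pi.mul_apply] at h3 h4
    rw [h3] at h1
    rw [h4] at h2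
    change ∫ x, (p.fst + q.fst) x * partialDeriv i φ x = -∫ x, (p.snd + q.snd) x i * φ x
    rw [h1, h2, hp φ hφ i, hq φ hφ i]
    ring
  smul_mem' := by
    intro c p hp φ hφ i
    have h1 : ∫ x, (c • p.fst) x * partialDeriv i φ x =
        ∫ x, c * (p.fst x * partialDeriv i φ x) := by
      refine integral_congr_ae ?_
      filter_upwards [Lp.coeFn_smul c p.fst] with x hx
      rw [hx]
      simp [mul_assoc]
    have h2 : ∫ x, (c • p.snd) x i * φ x = ∫ x, c * (p.snd x i * φ x) := by
      refine integral_congr_ae ?_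
      filter_upwards [Lp.coeFn_smul c p.snd] with x hx
      rw [hx]
      simp [mul_assoc]
    change ∫ x, (c • p.fst) x * partialDeriv i φ x = -∫ x, (c • p.snd) x i * φ x
    rw [h1, h2, integral_const_mul, integral_const_mul, hp φ hφ i]
    ring

/-- The function underlying an element of `H¹` (a representative of its a.e. class). -/
def fn (Ψ : H1) : R3 → ℝ := Ψ.1.fst

/-- The weak gradient of an element of `H¹` (a representative of its a.e. class). -/
def grad (Ψ : H1) : R3 → R3 := Ψ.1.snd

/-- `u` depends only on `|x|` (almost everywhere). -/
def IsRadial (u : R3 → ℝ) : Prop :=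
  ∃ f : ℝ → ℝ, Measurable f ∧ ∀ᵐ x : R3, u x = f ‖x‖

/-- The subspace `H¹_rad(ℝ³)` of radial functions in `H¹(ℝ³)`. -/
def H1rad : Submodule ℝ H1 where
  carrier := {Ψ | IsRadial (fn Ψ)}
  zero_mem' := by
    refine ⟨0, measurable_zero, ?_⟩
    filter_upwards [Lp.coeFn_zero ℝ 2 (volume : Measure R3)] with x hx
    exact hx
  add_mem' := by
    rintro p q ⟨f, hf, hpf⟩ ⟨g, hg, hqg⟩
    refine ⟨f + g, hf.add hg, ?_⟩
    filter_upwards [hpf, hqg, Lp.coeFn_add p.1.fst q.1.fst] with x h1 h2 h3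
    exact h3.trans (congrArg₂ (· + ·) h1 h2)
  smul_mem' := by
    rintro c p ⟨f, hf, hpf⟩
    refine ⟨c • f, hf.const_smul c, ?_⟩
    filter_upwards [hpf, Lp.coeFn_smul c p.1.fst] with x h1 h3
    exact h3.trans (congrArg (c • ·) h1)

/-- The set `Ξ_rad`: radial `H¹` functions with `∫ |Ψ|² = 1`. -/
def XiRad : Set H1 := {Ψ | Ψ ∈ H1rad ∧ ∫ x, |fn Ψ x| ^ 2 = 1}

/-- The Gaussian normalization constant `C_g = π^(-3/4)`. -/
def Cg : ℝ := 1 / Real.pi ^ (3 / 4 : ℝ)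

/-- The truncated logarithm `ln_{+,ξ}(s) = max (ln s, ξ)` for `s > 0`, with value `ξ` at `0`. -/
def lnPlus (ξ s : ℝ) : ℝ := if 0 < s then max (Real.log s) ξ else ξ

/-- The derivative `G'_{/κ,ξ}(s) = -κ² ln_{+,ξ}(κ⁻³ s / C_g²) - 3 κ²` of the regularized
logarithmic nonlinearity. -/
def Gprime (κ ξ s : ℝ) : ℝ := -κ ^ 2 * lnPlus ξ ((κ ^ 3)⁻¹ * s / Cg ^ 2) - 3 * κ ^ 2

/-- The nonlinearity `G_{/κ,ξ}(s) = ∫₀ˢ G'_{/κ,ξ}(t) dt`. -/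
def G (κ ξ s : ℝ) : ℝ := ∫ t in (0 : ℝ)..s, Gprime κ ξ t

/-- `g_{κ,ξ}(ψ) = G'_{/κ,ξ}(|ψ|²) ψ`. -/
def g (κ ξ ψ : ℝ) : ℝ := Gprime κ ξ (|ψ| ^ 2) * ψ

/-- The quadratic Coulomb energy `∫ (½ |∇Ψ|² - |Ψ|² / |x|) dx`. -/
def energyZero (Ψ : H1) : ℝ :=
  ∫ x, (1 / 2 * ‖grad Ψ x‖ ^ 2 - 1 / ‖x‖ * |fn Ψ x| ^ 2)

/-- The nonlinear part of the energy, `½ ∫ G_{/κ,ξ}(|Ψ|²) dx`. -/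
def energyNonlin (κ ξ : ℝ) (Ψ : H1) : ℝ := 1 / 2 * ∫ x, G κ ξ (|fn Ψ x| ^ 2)

/-- The energy functional `ℰ_{κ,ξ}`. -/
def energy (κ ξ : ℝ) (Ψ : H1) : ℝ := energyZero Ψ + energyNonlin κ ξ Ψ

/-- The duality pairing `⟨FΨ, φ⟩`, `φ ∈ H¹`, of the residual
`FΨ = ω Ψ + ½ ∇²Ψ + Ψ / |x| - ½ g_{κ,ξ}(Ψ)`, where `⟨∇²Ψ, φ⟩ = -∫ ∇Ψ · ∇φ`. -/
def residual (κ ξ ω : ℝ) (Ψ φ : H1) : ℝ :=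
  ω * (∫ x, fn Ψ x * fn φ x) - 1 / 2 * (∫ x, inner ℝ (grad Ψ x) (grad φ x))
    + (∫ x, 1 / ‖x‖ * fn Ψ x * fn φ x) - 1 / 2 * ∫ x, g κ ξ (fn Ψ x) * fn φ x

/-- The functionals `T j` on `H¹` are elements of `H⁻¹ = (H¹)*` that converge to zero in the norm
of `H⁻¹`. -/
def TendstoZeroHMinusOne (T : ℕ → H1 → ℝ) : Prop :=
  ∃ f : ℕ → StrongDual ℝ H1, (∀ j φ, f j φ = T j φ) ∧ Tendsto f atTop (𝓝 0)

end CoulombLog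

end

/-!
Everything reduces to one estimate for a radial function `u(x) = f(|x|)` in `H¹(ℝ³)`. Testing the
weak gradient against the field `η(|x|) x / |x|³`, where `x / |x|³` is divergence free, and letting
`η` approach the indicator of `[r, s]` gives
`|f(r) - f(s)|² ≤ (1/r - 1/s) ‖∇u‖² / |S²|` for almost all `r ≤ s` (`sq_profile_sub_le`).
Letting `s → ∞` yields the decay `|u(x)|² ≤ ‖∇u‖² / (|S²| |x|)` (`sq_fn_le_of_radial`). These two
bounds replace the Sobolev, Hardy and Rellich theorems:

* The decay makes the Coulomb energy infinitesimally small relative to the kinetic energy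
  (`integral_coulomb_le`) and the logarithm in `G'(|u|²)` at most `1 / |x|` plus the logarithm of
  the kinetic energy, so an upper bound on the energy bounds `‖∇Ψ_j‖` (`exists_kinetic_bound`).
* The Hölder bound is an equicontinuity statement away from the origin, so a diagonal argument gives
  a subsequence that converges almost everywhere (`exists_subseq_tendsto_ae`).

The function `G` is concave with `G(0) = 0`, so `s G'(s) ≤ G(s)`. Testing the residual with `Ψ_j`
therefore gives `ω_j ≤ ℰ(Ψ_j) + o(1) ≤ -β + o(1)` (`multiplier_le`).

Finally the difference of the residuals of `Ψ = Ψ_j` and `Φ = Ψ_k` is tested with `Ψ - Φ`. Because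
the logarithm is truncated, `g(ψ) = G'(0) ψ` for small `ψ`; by the decay, the remaining part of `g`
vanishes outside a fixed ball. The quadratic form that is left at infinity has the coefficient
`½ G'(0) - ω_j ≥ β - κ² (ξ + 3) / 2 - o(1)`, which is positive exactly by the smallness assumption
on `κ`, and the Coulomb potential outside a large ball is absorbed by it
(`norm_sub_le_residual_sub`). Inside the ball all remaining terms are dominated by a multiple of
the integrable function `1 / |x|²` and tend to zero (`tendsto_integral_localDefect`). Hence the
subsequence is Cauchy in `H¹`, and `H¹` and its radial subspace are closed.
-/

noncomputable section

namespace CoulombLog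

/-! ### Integration of radial functions -/

/-- The area of the unit sphere of `R3`, written as `3 vol(B₁)`; its numerical value `4π` plays no
role. -/
def sphereArea : ℝ := 3 * (volume : Measure R3).real (Metric.ball 0 1)

theorem sphereArea_pos : 0 < sphereArea := by
  have h : 0 < (volume : Measure R3).real (Metric.ball 0 1) :=
    ENNReal.toReal_pos (Metric.measure_ball_pos _ _ one_pos).ne' measure_ball_lt_top.ne
  unfold sphereArea
  positivity

theorem integral_radial (f : ℝ → ℝ) :
    ∫ x : R3, f ‖x‖ = sphereArea * ∫ r in Set.Ioi (0 : ℝ), r ^ 2 * f r := by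
  rw [integral_fun_norm_addHaar]
  simp [sphereArea, finrank_euclideanSpace, mul_assoc]

theorem integrable_radial_iff (f : ℝ → ℝ) :
    Integrable (fun x : R3 => f ‖x‖) ↔
      IntegrableOn (fun r => r ^ 2 * f r) (Set.Ioi (0 : ℝ)) := by
  rw [integrable_fun_norm_addHaar]
  simp [finrank_euclideanSpace]

theorem ae_ne_zero_R3 : ∀ᵐ x : R3, x ≠ 0 := by
  simp [ae_iff]

/-- The norm is nonsingular: it pulls null sets of radii back to null sets of points. -/
theorem ae_norm_of_ae {p : ℝ → Prop} (h : ∀ᵐ r : ℝ, p r) : ∀ᵐ x : R3, p ‖x‖ := by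
  obtain ⟨N, hpN, hN, hN0⟩ := exists_measurable_superset_of_null (ae_iff.1 h)
  have hmeas : MeasurableSet {x : R3 | ‖x‖ ∈ N} := measurable_norm hN
  have key : ∀ R : ℕ, volume ({x : R3 | ‖x‖ ∈ N} ∩ Metric.ball 0 R) = 0 := by
    intro R
    have h1 := integral_radial ((N ∩ Set.Iio (R : ℝ)).indicator 1)
    have h2 : ∫ r in Set.Ioi (0 : ℝ), r ^ 2 * ((N ∩ Set.Iio (R : ℝ)).indicator 1 r) = 0 := by
      refine integral_eq_zero_of_ae ?_
      have : ∀ᵐ r : ℝ, r ∉ N := by simpa [ae_iff] using hN0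
      filter_upwards [ae_restrict_of_ae this] with r hr
      simp [hr]
    have h3 : (fun x : R3 => (N ∩ Set.Iio (R : ℝ)).indicator (1 : ℝ → ℝ) ‖x‖) =
        ({x : R3 | ‖x‖ ∈ N} ∩ Metric.ball 0 R).indicator 1 := by
      ext x
      have hiff : ‖x‖ ∈ N ∩ Set.Iio (R : ℝ) ↔ x ∈ {x : R3 | ‖x‖ ∈ N} ∩ Metric.ball 0 R :=
        and_congr Iff.rfl (by simp)
      by_cases hx : ‖x‖ ∈ N ∩ Set.Iio (R : ℝ)
      · rw [Set.indicator_of_mem hx, Set.indicator_of_mem (hiff.1 hx)]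
        rfl
      · rw [Set.indicator_of_notMem hx, Set.indicator_of_notMem (mt hiff.2 hx)]
    rw [h2, mul_zero, h3, integral_indicator_one (hmeas.inter measurableSet_ball)] at h1
    refine (measureReal_eq_zero_iff ?_).1 h1
    exact ((measure_mono Set.inter_subset_right).trans_lt measure_ball_lt_top).ne
  have hall : volume {x : R3 | ‖x‖ ∈ N} = 0 := by
    refine measure_mono_null ?_ (measure_iUnion_null key)
    intro x hx
    obtain ⟨R, hR⟩ := exists_nat_gt ‖x‖
    exact Set.mem_iUnion.2 ⟨R, hx, by simpa using hR⟩
  rw [ae_iff]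
  exact measure_mono_null (fun x hx => hpN hx) hall

/-! ### Radial vector fields as test functions -/

theorem isTest_radialField {Θ : ℝ → ℝ} (hΘ : ContDiff ℝ ((⊤ : ℕ∞) : WithTop ℕ∞) Θ)
    (hc : HasCompactSupport Θ) (i : Fin 3) : IsTest fun x : R3 => Θ (‖x‖ ^ 2) * x i := by
  constructor
  · exact (hΘ.comp (contDiff_norm_sq ℝ)).mul (EuclideanSpace.proj (𝕜 := ℝ) i).contDiff
  · obtain ⟨R, hR⟩ := hc.isCompact.isBounded.subset_closedBall (0 : ℝ)
    refine HasCompactSupport.intro (isCompact_closedBall (0 : R3) (max R 1)) ?_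
    intro x hx
    have hx' : max R 1 < ‖x‖ := by simpa using hx
    have h1 : R < ‖x‖ ^ 2 := by
      have := le_max_left R 1
      have := le_max_right R 1
      nlinarith
    have : Θ (‖x‖ ^ 2) = 0 := by
      by_contra h
      have := hR (subset_tsupport Θ h)
      rw [Metric.mem_closedBall, dist_zero_right, Real.norm_of_nonneg (by positivity)] at this
      linarith
    simp [this]

theorem partialDeriv_radialField {Θ : ℝ → ℝ} (hΘ : ContDiff ℝ ((⊤ : ℕ∞) : WithTop ℕ∞) Θ)
    (i : Fin 3) (x : R3) : partialDeriv i (fun x : R3 => Θ (‖x‖ ^ 2) * x i) x =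
      Θ (‖x‖ ^ 2) + 2 * deriv Θ (‖x‖ ^ 2) * x i ^ 2 := by
  have hd : HasDerivAt Θ (deriv Θ (‖x‖ ^ 2)) (‖x‖ ^ 2) :=
    (hΘ.differentiable (by simp) _).hasDerivAt
  have h1 : HasFDerivAt (fun y : R3 => ‖y‖ ^ 2) (2 • innerSL ℝ x) x :=
    (hasStrictFDerivAt_norm_sq x).hasFDerivAt
  have h2 := hd.comp_hasFDerivAt x h1
  have h3 : HasFDerivAt (fun y : R3 => y i) (EuclideanSpace.proj (𝕜 := ℝ) i) x :=
    (EuclideanSpace.proj (𝕜 := ℝ) i).hasFDerivAt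
  have h4 := h2.mul h3
  unfold partialDeriv
  have h5 : (fun x : R3 => Θ (‖x‖ ^ 2) * x i) =
      (Θ ∘ fun y : R3 => ‖y‖ ^ 2) * fun y : R3 => y i := rfl
  rw [h5, h4.fderiv]
  simp [EuclideanSpace.inner_single_right]
  ring

/-- The weak gradient tested against the vector field `Θ(|x|²) x`, whose divergence is
`3 Θ(|x|²) + 2 |x|² Θ'(|x|²)`. -/
theorem IsWeakGradient.radialField {u : R3 → ℝ} {w : R3 → R3} (h : IsWeakGradient u w)
    (hu : MemLp u 2 volume) (hw : MemLp w 2 volume) {Θ : ℝ → ℝ}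
    (hΘ : ContDiff ℝ ((⊤ : ℕ∞) : WithTop ℕ∞) Θ) (hc : HasCompactSupport Θ) :
    ∫ x, u x * (3 * Θ (‖x‖ ^ 2) + 2 * ‖x‖ ^ 2 * deriv Θ (‖x‖ ^ 2)) =
      -∫ x, inner ℝ (w x) (Θ (‖x‖ ^ 2) • x) := by
  have ht := isTest_radialField hΘ hc
  have h1 : ∀ x : R3, u x * (3 * Θ (‖x‖ ^ 2) + 2 * ‖x‖ ^ 2 * deriv Θ (‖x‖ ^ 2)) =
      ∑ i : Fin 3, u x * partialDeriv i (fun x : R3 => Θ (‖x‖ ^ 2) * x i) x := by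
    intro x
    simp only [partialDeriv_radialField hΘ]
    rw [← Finset.mul_sum, Finset.sum_add_distrib, ← Finset.mul_sum,
      ← EuclideanSpace.real_norm_sq_eq]
    simp
    left
    ring
  have h2 : ∀ x : R3, inner ℝ (w x) (Θ (‖x‖ ^ 2) • x) =
      ∑ i : Fin 3, w x i * (Θ (‖x‖ ^ 2) * x i) := by
    intro x
    simp [PiLp.inner_apply, mul_comm]
  simp only [h1, h2]
  rw [integral_finsetSum, integral_finsetSum, ← Finset.sum_neg_distrib]
  · exact Finset.sum_congr rfl fun i _ => h _ (ht i) i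
  · exact fun i _ => (memLp_coord hw i).integrable_mul (ht i).memLp
  · exact fun i _ => hu.integrable_mul ((ht i).memLp_partialDeriv i)

theorem sq_integral_inner_le {v w : R3 → R3} (hv : MemLp v 2 volume) (hw : MemLp w 2 volume) :
    (∫ x, inner ℝ (v x) (w x)) ^ 2 ≤ (∫ x, ‖v x‖ ^ 2) * ∫ x, ‖w x‖ ^ 2 := by
  have key : ∀ {a b : R3 → R3} (ha : MemLp a 2 volume) (hb : MemLp b 2 volume),
      inner ℝ (ha.toLp a) (hb.toLp b) = ∫ x, inner ℝ (a x) (b x) := by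
    intro a b ha hb
    rw [L2.inner_def]
    refine integral_congr_ae ?_
    filter_upwards [ha.coeFn_toLp, hb.coeFn_toLp] with x h1 h2
    rw [h1, h2]
  have h1 : ∀ {a : R3 → R3} (ha : MemLp a 2 volume), ‖ha.toLp a‖ ^ 2 = ∫ x, ‖a x‖ ^ 2 := by
    intro a ha
    rw [← real_inner_self_eq_norm_sq, key]
    simp
  rw [← key hv hw, ← h1 hv, ← h1 hw, ← mul_pow, sq_le_sq, abs_mul, abs_norm, abs_norm]
  exact abs_real_inner_le_norm _ _

/-- Testing with the field `η(|x|) x / |x|³`, of divergence `η'(|x|) / |x|²`, bounds the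
distributional derivative of the radial profile. -/
theorem sq_integral_profile_mul_deriv_le {u : R3 → ℝ} {w : R3 → R3} (h : IsWeakGradient u w)
    (hu : MemLp u 2 volume) (hw : MemLp w 2 volume) {f : ℝ → ℝ} (hf : ∀ᵐ x : R3, u x = f ‖x‖)
    {η : ℝ → ℝ} (hη : ContDiff ℝ ((⊤ : ℕ∞) : WithTop ℕ∞) η) {a b : ℝ} (ha : 0 < a) (hab : a ≤ b)
    (hsupp : ∀ t, t ∉ Set.Icc a b → η t = 0) (hle : ∀ t, |η t| ≤ 1) :
    sphereArea * (∫ r in Set.Ioi (0 : ℝ), f r * deriv η r) ^ 2 ≤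
      (1 / a - 1 / b) * ∫ x, ‖w x‖ ^ 2 := by
  -- the field is `Θ(|x|²) x`; since `η` vanishes near zero, the square root costs no smoothness
  set Θ : ℝ → ℝ := fun q => η (√q) / √q ^ 3 with hΘdef
  have hzero : ∀ q, q < a ^ 2 → Θ q = 0 := by
    intro q hq
    have : √q < a := by rwa [Real.sqrt_lt' ha]
    simp [hΘdef, hsupp (√q) (fun h => by linarith [h.1])]
  have hΘ : ContDiff ℝ ((⊤ : ℕ∞) : WithTop ℕ∞) Θ := by
    rw [contDiff_iff_contDiffAt]
    intro q
    rcases le_or_gt q 0 with hq | hq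
    · have : Θ =ᶠ[𝓝 q] fun _ => 0 := by
        filter_upwards [Iio_mem_nhds (show q < a ^ 2 by nlinarith)] with y hy using hzero y hy
      exact contDiffAt_const.congr_of_eventuallyEq this
    · have hs := Real.contDiffAt_sqrt (n := ((⊤ : ℕ∞) : WithTop ℕ∞)) hq.ne'
      refine ContDiffAt.div ((hη.contDiffAt).comp q hs) (hs.pow 3) ?_
      have := Real.sqrt_pos.2 hq
      positivity
  have hc : HasCompactSupport Θ := by
    refine HasCompactSupport.intro (isCompact_Icc (a := (0 : ℝ)) (b := b ^ 2)) ?_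
    intro q hq
    by_cases h0 : q < a ^ 2
    · exact hzero q h0
    · have hqb : b ^ 2 < q := by
        by_contra hcon
        exact hq ⟨by nlinarith, by linarith⟩
      have : b < √q := Real.lt_sqrt_of_sq_lt hqb
      simp [hΘdef, hsupp (√q) (fun h => by linarith [h.2])]
  have hΘn : ∀ r : ℝ, 0 < r → Θ (r ^ 2) = η r / r ^ 3 := by
    intro r hr
    simp [hΘdef, Real.sqrt_sq hr.le]
  have hΘd : ∀ r : ℝ, 0 < r → 3 * Θ (r ^ 2) + 2 * r ^ 2 * deriv Θ (r ^ 2) = deriv η r / r ^ 2 := by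
    intro r hr
    have h1 : HasDerivAt (fun t => Θ (t ^ 2)) (deriv Θ (r ^ 2) * (2 * r)) r := by
      have := (hΘ.differentiable (by simp) (r ^ 2)).hasDerivAt.comp r (hasDerivAt_pow 2 r)
      simpa [Function.comp_def] using this
    have h2 : HasDerivAt (fun t => η t / t ^ 3)
        ((deriv η r * r ^ 3 - η r * (3 * r ^ 2)) / (r ^ 3) ^ 2) r := by
      have := (hη.differentiable (by simp) r).hasDerivAt.div (hasDerivAt_pow 3 r) (by positivity)
      simpa [Pi.div_def] using this
    have h3 := h1.congr_of_eventuallyEq (f₁ := fun t => η t / t ^ 3) (by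
      filter_upwards [Ioi_mem_nhds hr] with t ht using (hΘn t ht).symm)
    have h4 := h2.unique h3
    rw [hΘn r hr]
    have h5 : 2 * r ^ 2 * deriv Θ (r ^ 2) = r * (deriv Θ (r ^ 2) * (2 * r)) := by ring
    rw [h5, ← h4]
    field_simp
    ring
  have hmain := h.radialField hu hw hΘ hc
  have hL : ∫ x, u x * (3 * Θ (‖x‖ ^ 2) + 2 * ‖x‖ ^ 2 * deriv Θ (‖x‖ ^ 2)) =
      sphereArea * ∫ r in Set.Ioi (0 : ℝ), f r * deriv η r := by
    have h1 : ∫ x, u x * (3 * Θ (‖x‖ ^ 2) + 2 * ‖x‖ ^ 2 * deriv Θ (‖x‖ ^ 2)) =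
        ∫ x : R3, (fun r => f r * (deriv η r / r ^ 2)) ‖x‖ := by
      refine integral_congr_ae ?_
      filter_upwards [hf, ae_ne_zero_R3] with x hx hx0
      rw [hx, hΘd _ (norm_pos_iff.2 hx0)]
    rw [h1, integral_radial fun r => f r * (deriv η r / r ^ 2)]
    congr 1
    refine setIntegral_congr_fun measurableSet_Ioi ?_
    intro r hr
    have : r ≠ 0 := (Set.mem_Ioi.1 hr).ne'
    simp only
    field_simp
  have hv : MemLp (fun x : R3 => Θ (‖x‖ ^ 2) • x) 2 volume := by
    have hcont : Continuous fun x : R3 => Θ (‖x‖ ^ 2) • x :=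
      (hΘ.continuous.comp (by fun_prop)).smul continuous_id
    refine hcont.memLp_of_hasCompactSupport ?_
    refine HasCompactSupport.intro (isCompact_closedBall (0 : R3) b) ?_
    intro x hx
    have hx' : b < ‖x‖ := by simpa using hx
    rw [hΘn _ (by linarith), hsupp _ (fun h => by linarith [h.2])]
    simp
  have hV : ∫ x : R3, ‖Θ (‖x‖ ^ 2) • x‖ ^ 2 ≤ sphereArea * (1 / a - 1 / b) := by
    have h1 : ∫ x : R3, ‖Θ (‖x‖ ^ 2) • x‖ ^ 2 = ∫ x : R3, (fun r => η r ^ 2 / r ^ 4) ‖x‖ := by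
      refine integral_congr_ae ?_
      filter_upwards [ae_ne_zero_R3] with x hx0
      have hp := norm_pos_iff.2 hx0
      rw [hΘn _ hp, norm_smul, mul_pow, Real.norm_eq_abs, sq_abs]
      field_simp
    rw [h1, integral_radial fun r => η r ^ 2 / r ^ 4]
    refine mul_le_mul_of_nonneg_left ?_ sphereArea_pos.le
    have hderiv : ∀ r ∈ Set.uIcc a b, HasDerivAt (fun r : ℝ => -(1 / r)) (1 / r ^ 2) r := by
      intro r hr
      rw [Set.uIcc_of_le hab] at hr
      have hr0 : r ≠ 0 := (ha.trans_le hr.1).ne'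
      have := (hasDerivAt_inv hr0).neg
      simpa [one_div, Pi.neg_def] using this
    have hcont : ContinuousOn (fun r : ℝ => 1 / r ^ 2) (Set.Icc a b) := by
      refine continuousOn_const.div (by fun_prop) ?_
      intro r hr
      have := ha.trans_le hr.1
      positivity
    have hint : IntervalIntegrable (fun r : ℝ => 1 / r ^ 2) volume a b := by
      refine ContinuousOn.intervalIntegrable ?_
      rwa [Set.uIcc_of_le hab]
    have h2 : ∫ r in a..b, 1 / r ^ 2 = 1 / a - 1 / b := by
      rw [intervalIntegral.integral_eq_sub_of_hasDerivAt hderiv hint]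
      ring
    rw [← h2, intervalIntegral.integral_of_le hab, ← integral_Icc_eq_integral_Ioc,
      ← integral_indicator measurableSet_Icc, ← integral_indicator measurableSet_Ioi]
    refine integral_mono_of_nonneg (ae_of_all _ fun r => ?_)
      ((integrable_indicator_iff measurableSet_Icc).2 hcont.integrableOn_Icc)
      (ae_of_all _ fun r => ?_)
    · refine Set.indicator_nonneg (fun r _ => ?_) r
      positivity
    · by_cases hr : r ∈ Set.Icc a b
      · have hr0 : 0 < r := ha.trans_le hr.1
        rw [Set.indicator_of_mem (Set.mem_Ioi.2 hr0), Set.indicator_of_mem hr]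
        have h3 : η r ^ 2 ≤ 1 := by
          rw [← sq_abs]
          exact pow_le_one₀ (abs_nonneg _) (hle r)
        have h4 : r ^ 2 * (η r ^ 2 / r ^ 4) = η r ^ 2 * (1 / r ^ 2) := by field_simp
        rw [h4]
        exact mul_le_of_le_one_left (by positivity) h3
      · rw [Set.indicator_of_notMem hr]
        refine (Set.indicator_apply_le' (fun _ => ?_) fun _ => le_rfl)
        simp [hsupp r hr]
  rw [hL] at hmain
  have hCS := sq_integral_inner_le hw hv
  have h6 : (sphereArea * ∫ r in Set.Ioi (0 : ℝ), f r * deriv η r) ^ 2 ≤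
      (∫ x, ‖w x‖ ^ 2) * (sphereArea * (1 / a - 1 / b)) := by
    rw [hmain, neg_sq]
    exact hCS.trans (mul_le_mul_of_nonneg_left hV (integral_nonneg fun _ => by positivity))
  have hs := sphereArea_pos
  refine le_of_mul_le_mul_left ?_ hs
  calc _ = (sphereArea * ∫ r in Set.Ioi (0 : ℝ), f r * deriv η r) ^ 2 := by ring
    _ ≤ _ := h6
    _ = _ := by ring

/-! ### Hölder continuity of radial profiles -/

/-- A smoothed indicator function of `[r, s]`: the primitive of a bump at `r` minus the same bump
at `s`. -/
theorem exists_smooth_indicator (φ : ContDiffBump (0 : ℝ)) {r s : ℝ} (hrs : r ≤ s) :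
    ∃ η : ℝ → ℝ, ContDiff ℝ ((⊤ : ℕ∞) : WithTop ℕ∞) η ∧
      (∀ t, deriv η t = φ.normed volume (r - t) - φ.normed volume (s - t)) ∧
      (∀ t, t ∉ Set.Icc (r - φ.rOut) (s + φ.rOut) → η t = 0) ∧ ∀ t, |η t| ≤ 1 := by
  set p : ℝ → ℝ := φ.normed volume with hp
  have hpc : Continuous p := φ.continuous_normed
  have hpi : Integrable p := φ.integrable_normed
  have hp0 : ∀ t, 0 ≤ p t := φ.nonneg_normed
  have hps : ∀ t, φ.rOut ≤ |t| → p t = 0 := by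
    intro t ht
    by_contra h
    have h1 : t ∈ Function.support p := h
    rw [hp, φ.support_normed_eq, Metric.mem_ball, dist_zero_right, Real.norm_eq_abs] at h1
    linarith
  have hderiv : ∀ t,
      HasDerivAt (fun t => ∫ τ in (t - s)..(t - r), p τ) (p (r - t) - p (s - t)) t := by
    intro t
    have h0 : ∀ c : ℝ, HasDerivAt (fun t => ∫ τ in (0 : ℝ)..(t - c), p τ) (p (t - c)) t := by
      intro c
      have h1 : HasDerivAt (fun x => ∫ τ in (0 : ℝ)..x, p τ) (p (t - c)) (t - c) :=
        intervalIntegral.integral_hasDerivAt_right (hpc.intervalIntegrable _ _)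
          (hpc.stronglyMeasurableAtFilter _ _) hpc.continuousAt
      have h2 : HasDerivAt (fun t : ℝ => t - c) 1 t := (hasDerivAt_id t).sub_const c
      simpa [Function.comp_def] using h1.comp t h2
    have h3 := (h0 r).sub (h0 s)
    have h4 : ∀ c : ℝ, p (t - c) = p (c - t) := by
      intro c
      rw [hp, ← φ.normed_neg, neg_sub]
    rw [h4 r, h4 s] at h3
    refine h3.congr_of_eventuallyEq (Eventually.of_forall fun x => ?_)
    exact (intervalIntegral.integral_interval_sub_left (hpc.intervalIntegrable _ _)
      (hpc.intervalIntegrable _ _)).symm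
  have hle : ∀ t, t - s ≤ t - r := fun t => by linarith
  refine ⟨fun t => ∫ τ in (t - s)..(t - r), p τ, ?_, fun t => (hderiv t).deriv, ?_, ?_⟩
  · rw [contDiff_infty_iff_deriv]
    refine ⟨fun t => (hderiv t).differentiableAt, ?_⟩
    have : deriv (fun t => ∫ τ in (t - s)..(t - r), p τ) = fun t => p (r - t) - p (s - t) :=
      funext fun t => (hderiv t).deriv
    rw [this]
    have hsm : ContDiff ℝ ((⊤ : ℕ∞) : WithTop ℕ∞) p := φ.contDiff_normed
    exact (hsm.comp (contDiff_const.sub contDiff_id)).sub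
      (hsm.comp (contDiff_const.sub contDiff_id))
  · intro t ht
    simp only
    rw [intervalIntegral.integral_of_le (hle t)]
    refine setIntegral_eq_zero_of_forall_eq_zero fun τ hτ => hps τ ?_
    by_contra hcon
    have h1 := abs_lt.1 (not_le.1 hcon)
    exact ht ⟨by linarith [hτ.2], by linarith [hτ.1]⟩
  · intro t
    simp only
    rw [intervalIntegral.integral_of_le (hle t), abs_of_nonneg (integral_nonneg fun τ => hp0 τ)]
    exact (setIntegral_le_integral hpi (ae_of_all _ hp0)).trans_eq φ.integral_normed

/-- The radial profile of an `H¹` function is Hölder continuous away from the origin,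
`|f(r) - f(s)|² ≤ |1/r - 1/s| ‖∇u‖² / |S²|`, outside a null set of radii. -/
theorem sq_profile_sub_le {u : R3 → ℝ} {w : R3 → R3} (h : IsWeakGradient u w)
    (hu : MemLp u 2 volume) (hw : MemLp w 2 volume) {f : ℝ → ℝ} (hfm : Measurable f)
    (hf : ∀ᵐ x : R3, u x = f ‖x‖) :
    ∃ S : Set ℝ, (∀ᵐ r, r ∈ S) ∧ ∀ r ∈ S, ∀ s ∈ S, 0 < r → r ≤ s →
      sphereArea * (f r - f s) ^ 2 ≤ (1 / r - 1 / s) * ∫ x, ‖w x‖ ^ 2 := by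
  have hint : IntegrableOn (fun r => r ^ 2 * f r ^ 2) (Set.Ioi (0 : ℝ)) := by
    rw [← integrable_radial_iff fun r => f r ^ 2]
    refine ((memLp_two_iff_integrable_sq hu.1).1 hu).congr ?_
    filter_upwards [hf] with x hx
    rw [hx]
  -- cutting off small radii makes the profile locally integrable on the line
  have hloc : ∀ m : ℕ, LocallyIntegrable ((Set.Ioi (1 / ((m : ℝ) + 1))).indicator f) := by
    intro m
    have hδ : 0 < 1 / ((m : ℝ) + 1) := by positivity
    set δ := 1 / ((m : ℝ) + 1)
    have hmeas : Measurable ((Set.Ioi δ).indicator f) := hfm.indicator measurableSet_Ioi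
    have h2 : MemLp ((Set.Ioi δ).indicator f) 2 volume := by
      rw [memLp_two_iff_integrable_sq hmeas.aestronglyMeasurable]
      refine ((integrable_indicator_iff measurableSet_Ioi).2 (hint.const_mul ((δ ^ 2)⁻¹))).mono'
        (hmeas.pow_const 2).aestronglyMeasurable (ae_of_all _ fun r => ?_)
      by_cases hr : r ∈ Set.Ioi δ
      · have hr0 : r ∈ Set.Ioi (0 : ℝ) := hδ.trans hr
        rw [Set.indicator_of_mem hr, Set.indicator_of_mem hr0, Real.norm_of_nonneg (sq_nonneg _),
          ← mul_assoc]
        refine le_mul_of_one_le_left (sq_nonneg _) ?_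
        rw [inv_mul_eq_div, one_le_div (by positivity)]
        exact pow_le_pow_left₀ hδ.le (Set.mem_Ioi.1 hr).le 2
      · rw [Set.indicator_of_notMem hr]
        simp only [ne_eq, OfNat.ofNat_ne_zero, not_false_eq_true, zero_pow, norm_zero]
        exact Set.indicator_nonneg (fun r _ => by positivity) r
    exact h2.locallyIntegrable (by norm_num)
  -- mollification at scale `1 / (n + 1)` recovers the profile at almost every radius
  set φ : ℕ → ContDiffBump (0 : ℝ) := fun n =>
    ⟨1 / ((n : ℝ) + 1), 2 * (1 / ((n : ℝ) + 1)), by positivity, by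
      have : 0 < 1 / ((n : ℝ) + 1) := by positivity
      linarith⟩ with hφ
  have hφ0 : Tendsto (fun n => (φ n).rOut) atTop (𝓝 0) := by
    simpa [hφ] using (tendsto_one_div_add_atTop_nhds_zero_nat (𝕜 := ℝ)).const_mul 2
  have hae : ∀ᵐ r : ℝ, ∀ m : ℕ, Tendsto
      (fun n => convolution ((φ n).normed volume) ((Set.Ioi (1 / ((m : ℝ) + 1))).indicator f)
        (ContinuousLinearMap.lsmul ℝ ℝ) volume r) atTop
      (𝓝 ((Set.Ioi (1 / ((m : ℝ) + 1))).indicator f r)) :=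
    ae_all_iff.2 fun m => ContDiffBump.ae_convolution_tendsto_right_of_locallyIntegrable
      (K := 2) hφ0 (Eventually.of_forall fun n => le_rfl) (hloc m)
  refine ⟨_, hae, ?_⟩
  intro r hr s hs hr0 hrs
  obtain ⟨m, hm⟩ := exists_nat_one_div_lt hr0
  have hr' := hr m
  have hs' := hs m
  have hint' := hloc m
  set δ := 1 / ((m : ℝ) + 1) with hδ
  have hδ0 : 0 < δ := by positivity
  rw [Set.indicator_of_mem (show r ∈ Set.Ioi δ from hm)] at hr'
  rw [Set.indicator_of_mem (show s ∈ Set.Ioi δ from hm.trans_le hrs)] at hs'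
  have hlim := (((hr'.sub hs').pow 2).const_mul sphereArea)
  have hε1 : Tendsto (fun n => r - (φ n).rOut) atTop (𝓝 r) := by
    simpa using tendsto_const_nhds.sub hφ0
  have hε2 : Tendsto (fun n => s + (φ n).rOut) atTop (𝓝 s) := by
    simpa using tendsto_const_nhds.add hφ0
  have hlim2 : Tendsto
      (fun n => (1 / (r - (φ n).rOut) - 1 / (s + (φ n).rOut)) * ∫ x, ‖w x‖ ^ 2) atTop
      (𝓝 ((1 / r - 1 / s) * ∫ x, ‖w x‖ ^ 2)) :=
    ((tendsto_const_nhds.div hε1 hr0.ne').sub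
      (tendsto_const_nhds.div hε2 (hr0.trans_le hrs).ne')).mul_const _
  refine le_of_tendsto_of_tendsto hlim hlim2 ?_
  filter_upwards [hε1.eventually (lt_mem_nhds hm)] with n hn
  obtain ⟨η, hη, hηd, hηs, hη1⟩ := exists_smooth_indicator (φ n) hrs
  have hpos := (φ n).rOut_pos
  have hmain := sq_integral_profile_mul_deriv_le h hu hw hf hη (hδ0.trans hn) (by linarith) hηs hη1
  refine le_of_eq_of_le ?_ hmain
  congr 2
  simp only [convolution_eq_swap, ContinuousLinearMap.lsmul_apply, smul_eq_mul]
  have hi : ∀ c : ℝ, Integrable fun t => (φ n).normed volume (c - t) *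
      (Set.Ioi δ).indicator f t := by
    intro c
    have hcs : HasCompactSupport fun t => (φ n).normed volume (c - t) :=
      (φ n).hasCompactSupport_normed.comp_homeomorph (Homeomorph.subLeft c)
    exact hint'.integrable_smul_left_of_hasCompactSupport
      ((φ n).continuous_normed.comp (by fun_prop)) hcs
  rw [← integral_sub (hi r) (hi s), ← integral_indicator measurableSet_Ioi]
  refine integral_congr_ae (ae_of_all _ fun t => ?_)
  simp only
  rw [← sub_mul, ← hηd t]
  by_cases ht : t ∈ Set.Ioi δ
  · rw [Set.indicator_of_mem ht, Set.indicator_of_mem (show t ∈ Set.Ioi (0 : ℝ) from hδ0.trans ht),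
      mul_comm]
  · rw [Set.indicator_of_notMem ht, mul_zero]
    have : deriv η t = 0 := by
      have ht' : t ≤ δ := not_lt.1 ht
      have hz : ∀ c, r ≤ c → (φ n).normed volume (c - t) = 0 := by
        intro c hc
        by_contra hne
        have h1 : c - t ∈ Function.support ((φ n).normed volume) := hne
        rw [(φ n).support_normed_eq, Metric.mem_ball, dist_zero_right, Real.norm_eq_abs] at h1
        linarith [(abs_lt.1 h1).2]
      rw [hηd, hz r le_rfl, hz s hrs, sub_zero]
    refine (Set.indicator_apply_eq_zero.2 fun _ => ?_).symm
    rw [this, mul_zero]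

/-! ### The Hilbert space structure of `H¹` -/

/-- Completeness of a closed subspace of a product of complete spaces, relative to a closed subset.
Stating it for abstract factors keeps the comparison of the subspace topology with the norm topology
independent of how `L²` is built. -/
theorem exists_mem_tendsto_of_tendsto_sq_norm_sub {E F : Type*} [NormedAddCommGroup E]
    [NormedSpace ℝ E] [CompleteSpace E] [NormedAddCommGroup F] [NormedSpace ℝ F] [CompleteSpace F]
    {S : Submodule ℝ (WithLp 2 (E × F))} (hS : IsClosed (S : Set (WithLp 2 (E × F)))) {T : Set S}
    (hT : IsClosed T) {u : ℕ → S} (hu : ∀ k, u k ∈ T)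
    (h : Tendsto (fun p : ℕ × ℕ => ‖u p.1 - u p.2‖ ^ 2) atTop (𝓝 0)) :
    ∃ l ∈ T, Tendsto u atTop (𝓝 l) := by
  have : CompleteSpace S := hS.completeSpace_coe
  have hc : CauchySeq u := by
    refine cauchySeq_iff_tendsto_dist_atTop_0.2 ?_
    simpa [dist_eq_norm] using h.sqrt
  obtain ⟨l, hl⟩ := cauchySeq_tendsto_of_complete hc
  exact ⟨l, hT.mem_of_tendsto hl (Eventually.of_forall hu), hl⟩

theorem memLp_fn (Ψ : H1) : MemLp (fn Ψ) 2 volume := Lp.memLp Ψ.1.fst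

theorem memLp_grad (Ψ : H1) : MemLp (grad Ψ) 2 volume := Lp.memLp Ψ.1.snd

theorem isWeakGradient_grad (Ψ : H1) : IsWeakGradient (fn Ψ) (grad Ψ) := Ψ.2

theorem integral_fn_mul (Ψ Φ : H1) : ∫ x, fn Ψ x * fn Φ x = inner ℝ Ψ.1.fst Φ.1.fst := by
  rw [L2.inner_def]
  refine integral_congr_ae (ae_of_all _ fun x => ?_)
  simp [fn, mul_comm]

theorem integral_inner_grad (Ψ Φ : H1) :
    ∫ x, inner ℝ (grad Ψ x) (grad Φ x) = inner ℝ Ψ.1.snd Φ.1.snd := by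
  rw [L2.inner_def]
  rfl

theorem integral_sq_fn (Ψ : H1) : ∫ x, fn Ψ x ^ 2 = ‖Ψ.1.fst‖ ^ 2 := by
  rw [← real_inner_self_eq_norm_sq, ← integral_fn_mul]
  simp only [sq]

theorem integral_sq_grad (Ψ : H1) : ∫ x, ‖grad Ψ x‖ ^ 2 = ‖Ψ.1.snd‖ ^ 2 := by
  rw [← real_inner_self_eq_norm_sq, ← integral_inner_grad]
  simp

theorem H1.norm_sq_eq (Ψ : H1) : ‖Ψ‖ ^ 2 = ‖Ψ.1.fst‖ ^ 2 + ‖Ψ.1.snd‖ ^ 2 :=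
  WithLp.prod_norm_sq_eq_of_L2 Ψ.1

theorem fn_sub_ae (Ψ Φ : H1) : ∀ᵐ x, fn (Ψ - Φ) x = fn Ψ x - fn Φ x :=
  Lp.coeFn_sub Ψ.1.fst Φ.1.fst

theorem integrable_sq_fn (Ψ : H1) : Integrable fun x => fn Ψ x ^ 2 :=
  (memLp_two_iff_integrable_sq (memLp_fn Ψ).1).1 (memLp_fn Ψ)

/-- Each instance of the weak gradient identity equates two continuous linear functionals. -/
theorem isClosed_H1 : IsClosed (H1 : Set (WithLp 2
    (Lp ℝ 2 (volume : Measure R3) × Lp R3 2 (volume : Measure R3)))) := by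
  have hset : (H1 : Set (WithLp 2
      (Lp ℝ 2 (volume : Measure R3) × Lp R3 2 (volume : Measure R3)))) =
      ⋂ (φ : R3 → ℝ) (_ : IsTest φ) (i : Fin 3), {p | ∫ x, p.fst x * partialDeriv i φ x =
        -∫ x, p.snd x i * φ x} := by
    ext p
    simp only [Set.mem_iInter]
    rfl
  rw [hset]
  refine isClosed_iInter fun φ => isClosed_iInter fun hφ => isClosed_iInter fun i => ?_
  have hd := hφ.memLp_partialDeriv i
  have hv : MemLp (fun x => EuclideanSpace.single i (φ x)) 2 (volume : Measure R3) := by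
    have h1 : MemLp (fun x => φ x • (EuclideanSpace.single i 1 : R3)) 2 (volume : Measure R3) := by
      have := (ContinuousLinearMap.toSpanSingleton ℝ
        (EuclideanSpace.single i 1 : R3)).comp_memLp' hφ.memLp
      simpa [Function.comp_def] using this
    refine h1.congr_norm ?_ ?_
    · refine h1.1.congr (ae_of_all _ fun x => ?_)
      ext j
      by_cases hj : j = i <;> simp [hj]
    · refine ae_of_all _ fun x => ?_
      simp [norm_smul]
  have h1 : ∀ p : WithLp 2 (Lp ℝ 2 (volume : Measure R3) × Lp R3 2 (volume : Measure R3)),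
      ∫ x, p.fst x * partialDeriv i φ x = inner ℝ (hd.toLp _) p.fst := by
    intro p
    rw [L2.inner_def]
    refine integral_congr_ae ?_
    filter_upwards [hd.coeFn_toLp] with x hx
    rw [hx]
    simp
  have h2 : ∀ p : WithLp 2 (Lp ℝ 2 (volume : Measure R3) × Lp R3 2 (volume : Measure R3)),
      ∫ x, p.snd x i * φ x = inner ℝ (hv.toLp _) p.snd := by
    intro p
    rw [L2.inner_def]
    refine integral_congr_ae ?_
    filter_upwards [hv.coeFn_toLp] with x hx
    rw [hx]
    simp [EuclideanSpace.inner_single_left, mul_comm]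
  simp only [h1, h2]
  have hc1 : Continuous fun p : WithLp 2
      (Lp ℝ 2 (volume : Measure R3) × Lp R3 2 (volume : Measure R3)) => p.fst :=
    (WithLp.prod_continuous_ofLp 2 _ _).fst
  have hc2 : Continuous fun p : WithLp 2
      (Lp ℝ 2 (volume : Measure R3) × Lp R3 2 (volume : Measure R3)) => p.snd :=
    (WithLp.prod_continuous_ofLp 2 _ _).snd
  exact isClosed_eq (continuous_const.inner hc1) (continuous_const.inner hc2).neg


theorem isClosed_H1rad : IsClosed (H1rad : Set H1) := by
  refine IsSeqClosed.isClosed ?_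
  intro Φ Ψ hΦ hlim
  have hc : Continuous fun p : H1 => p.1.fst :=
    (WithLp.prod_continuous_ofLp 2 _ _).fst.comp continuous_subtype_val
  have h1 : Tendsto (fun n => (Φ n).1.fst) atTop (𝓝 Ψ.1.fst) := (hc.tendsto Ψ).comp hlim
  obtain ⟨ns, hns, hae⟩ := (tendstoInMeasure_of_tendsto_Lp h1).exists_seq_tendsto_ae
  have hΦ' : ∀ n, ∃ f : ℝ → ℝ, Measurable f ∧ ∀ᵐ x : R3, fn (Φ n) x = f ‖x‖ := hΦ
  choose f hfm hf using hΦ'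
  -- the pointwise `limsup` of the profiles is a measurable profile of the limit
  refine ⟨fun r => limsup (fun k => f (ns k) r) atTop,
    Measurable.limsup fun k => hfm (ns k), ?_⟩
  filter_upwards [hae, ae_all_iff.2 hf] with x hx hfx
  have h2 : Tendsto (fun k => f (ns k) ‖x‖) atTop (𝓝 (fn Ψ x)) :=
    hx.congr fun k => hfx (ns k)
  exact h2.limsup_eq.symm

/-! ### Decay and Coulomb bounds for radial functions -/

/-- Pointwise decay of radial `H¹` functions: letting `s → ∞` in the Hölder bound, where the
profile has to vanish because `u` is square integrable. -/
theorem sq_fn_le_of_radial {Ψ : H1} (hΨ : Ψ ∈ H1rad) :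
    ∀ᵐ x : R3, fn Ψ x ^ 2 ≤ ‖Ψ.1.snd‖ ^ 2 / sphereArea * (1 / ‖x‖) := by
  obtain ⟨f, hfm, hf⟩ : IsRadial (fn Ψ) := hΨ
  obtain ⟨S, hS, hSf⟩ :=
    sq_profile_sub_le (isWeakGradient_grad Ψ) (memLp_fn Ψ) (memLp_grad Ψ) hfm hf
  rw [integral_sq_grad] at hSf
  have hγ := sphereArea_pos
  filter_upwards [hf, ae_norm_of_ae hS, ae_ne_zero_R3] with x hx hxS hx0
  have hr := norm_pos_iff.2 hx0
  rw [hx]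
  set r := ‖x‖
  by_contra! hcon
  set b := √(‖Ψ.1.snd‖ ^ 2 / sphereArea * (1 / r)) with hb
  have hbf : b < |f r| := by
    rw [hb, Real.sqrt_lt' (lt_of_le_of_ne (abs_nonneg _) ?_), sq_abs]
    · exact hcon
    · intro h0
      rw [abs_eq_zero.1 h0.symm] at hcon
      have : 0 ≤ ‖Ψ.1.snd‖ ^ 2 / sphereArea * (1 / r) := by positivity
      simp only [ne_eq, OfNat.ofNat_ne_zero, not_false_eq_true, zero_pow] at hcon
      linarith
  -- otherwise `|u| ≥ |f r| - b > 0` on the whole exterior of a ball, which has infinite measure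
  have hfar : ∀ᵐ y : R3, r ≤ ‖y‖ → |f r| - b ≤ ‖fn Ψ y‖ := by
    filter_upwards [hf, ae_norm_of_ae hS] with y hy hyS hry
    have h1 := hSf r hxS ‖y‖ hyS hr hry
    have h2 : (f r - f ‖y‖) ^ 2 ≤ ‖Ψ.1.snd‖ ^ 2 / sphereArea * (1 / r) := by
      have h3 : (1 / r - 1 / ‖y‖) * ‖Ψ.1.snd‖ ^ 2 ≤ 1 / r * ‖Ψ.1.snd‖ ^ 2 := by
        refine mul_le_mul_of_nonneg_right ?_ (sq_nonneg _)
        have : 0 ≤ 1 / ‖y‖ := by positivity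
        linarith
      rw [div_mul_eq_mul_div, le_div_iff₀ hγ]
      linarith
    have h4 : |f r - f ‖y‖| ≤ b := Real.abs_le_sqrt h2
    have h5 := abs_sub_abs_le_abs_sub (f r) (f ‖y‖)
    rw [hy, Real.norm_eq_abs]
    linarith
  have hfin : volume {y : R3 | |f r| - b ≤ ‖fn Ψ y‖} < ⊤ := by
    have := (memLp_fn Ψ).meas_ge_lt_top (by norm_num) (by norm_num)
      (ε := (⟨|f r| - b, by linarith⟩ : NNReal)) (by
        intro h
        have h0 : |f r| - b = 0 := congrArg NNReal.toReal h
        linarith)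
    exact this
  have hinf : volume (Set.univ : Set R3) ≤
      volume (Metric.ball (0 : R3) r) + volume {y : R3 | |f r| - b ≤ ‖fn Ψ y‖} := by
    refine le_trans (measure_mono_ae ?_) (measure_union_le _ _)
    filter_upwards [hfar] with y hy _
    by_cases hyr : ‖y‖ < r
    · exact Or.inl (by simpa using hyr)
    · exact Or.inr (hy (not_lt.1 hyr))
  rw [measure_univ_of_isAddLeftInvariant] at hinf
  exact absurd hinf (not_le.2 (ENNReal.add_lt_top.2 ⟨measure_ball_lt_top, hfin⟩))

theorem integrable_indicator_inv_sq (ρ : ℝ) :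
    Integrable ((Metric.ball (0 : R3) ρ).indicator fun x => 1 / ‖x‖ ^ 2) := by
  rw [integrable_indicator_iff measurableSet_ball,
    integrableOn_fun_norm_addHaar (volume : Measure R3) (f := fun r => 1 / r ^ 2)]
  have : IntegrableOn (fun _ : ℝ => (1 : ℝ)) (Set.Ioo 0 ρ) := by simp
  refine this.congr_fun (fun r hr => ?_) measurableSet_Ioo
  have := hr.1.ne'
  simp [finrank_euclideanSpace, this]

theorem integral_indicator_inv_sq {ρ : ℝ} (hρ : 0 < ρ) :
    ∫ x, (Metric.ball (0 : R3) ρ).indicator (fun x => 1 / ‖x‖ ^ 2) x = sphereArea * ρ := by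
  have h1 : ∀ x : R3, (Metric.ball (0 : R3) ρ).indicator (fun x => 1 / ‖x‖ ^ 2) x =
      (fun r => (Set.Iio ρ).indicator (fun r => 1 / r ^ 2) r) ‖x‖ := by
    intro x
    by_cases hx : ‖x‖ < ρ <;> simp [hx]
  simp only [h1]
  rw [integral_radial fun r => (Set.Iio ρ).indicator (fun r => 1 / r ^ 2) r]
  congr 1
  have h2 : ∫ r in Set.Ioi (0 : ℝ), r ^ 2 * (Set.Iio ρ).indicator (fun r => 1 / r ^ 2) r =
      ∫ r in Set.Ioi (0 : ℝ), (Set.Iio ρ).indicator (fun _ => (1 : ℝ)) r := by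
    refine setIntegral_congr_fun measurableSet_Ioi fun r hr => ?_
    have hr0 : r ≠ 0 := (Set.mem_Ioi.1 hr).ne'
    by_cases hrρ : r < ρ <;> simp [hrρ, hr0]
  rw [h2, setIntegral_indicator measurableSet_Iio, Set.Ioi_inter_Iio]
  simp [hρ.le]

theorem aestronglyMeasurable_coulomb (Ψ Φ : H1) :
    AEStronglyMeasurable (fun x : R3 => 1 / ‖x‖ * (fn Ψ x * fn Φ x)) :=
  (measurable_norm.const_div 1).aestronglyMeasurable.mul ((memLp_fn Ψ).1.mul (memLp_fn Φ).1)

theorem coulomb_pointwise_le {Ψ : H1} (hΨ : Ψ ∈ H1rad) {ρ : ℝ} (hρ : 0 < ρ) :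
    ∀ᵐ x : R3, 1 / ‖x‖ * fn Ψ x ^ 2 ≤ ‖Ψ.1.snd‖ ^ 2 / sphereArea *
      (Metric.ball (0 : R3) ρ).indicator (fun x => 1 / ‖x‖ ^ 2) x + 1 / ρ * fn Ψ x ^ 2 := by
  filter_upwards [sq_fn_le_of_radial hΨ] with x hx
  by_cases hxρ : x ∈ Metric.ball (0 : R3) ρ
  · rw [Set.indicator_of_mem hxρ]
    have h1 := mul_le_mul_of_nonneg_left hx (show 0 ≤ 1 / ‖x‖ by positivity)
    have h2 : 0 ≤ 1 / ρ * fn Ψ x ^ 2 := by positivity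
    have h3 : 1 / ‖x‖ * (‖Ψ.1.snd‖ ^ 2 / sphereArea * (1 / ‖x‖)) =
      ‖Ψ.1.snd‖ ^ 2 / sphereArea * (1 / ‖x‖ ^ 2) := by ring
    linarith
  · rw [Set.indicator_of_notMem hxρ, mul_zero, zero_add]
    refine mul_le_mul_of_nonneg_right ?_ (sq_nonneg _)
    exact one_div_le_one_div_of_le hρ (by simpa using hxρ)

theorem integrable_coulomb_sq {Ψ : H1} (hΨ : Ψ ∈ H1rad) :
    Integrable fun x : R3 => 1 / ‖x‖ * fn Ψ x ^ 2 := by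
  refine (((integrable_indicator_inv_sq 1).const_mul (‖Ψ.1.snd‖ ^ 2 / sphereArea)).add
    ((integrable_sq_fn Ψ).const_mul (1 / 1))).mono' ?_ ?_
  · simpa only [sq] using aestronglyMeasurable_coulomb Ψ Ψ
  · filter_upwards [coulomb_pointwise_le hΨ one_pos] with x hx
    rw [Real.norm_of_nonneg (by positivity)]
    exact hx

/-- The Coulomb energy is infinitesimally bounded by the kinetic energy. -/
theorem integral_coulomb_le {Ψ : H1} (hΨ : Ψ ∈ H1rad) {ρ : ℝ} (hρ : 0 < ρ) :
    ∫ x, 1 / ‖x‖ * fn Ψ x ^ 2 ≤ ρ * ‖Ψ.1.snd‖ ^ 2 + 1 / ρ * ‖Ψ.1.fst‖ ^ 2 := by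
  have h1 := (integrable_indicator_inv_sq ρ).const_mul (‖Ψ.1.snd‖ ^ 2 / sphereArea)
  have h2 := (integrable_sq_fn Ψ).const_mul (1 / ρ)
  have h3 := integral_mono_ae (integrable_coulomb_sq hΨ) (h1.add h2) (coulomb_pointwise_le hΨ hρ)
  rw [integral_add' h1 h2, integral_const_mul, integral_const_mul,
    integral_indicator_inv_sq hρ, integral_sq_fn] at h3
  have hγ := sphereArea_pos.ne'
  refine h3.trans_eq ?_
  field_simp

/-- Products of radial `H¹` functions are integrable against the weight `1 + 1 / |x|`. -/
theorem integrable_weighted_mul {Ψ Φ : H1} (hΨ : Ψ ∈ H1rad) (hΦ : Φ ∈ H1rad) :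
    Integrable fun x : R3 => (1 + 1 / ‖x‖) * (fn Ψ x * fn Φ x) := by
  have h1 : Integrable fun x : R3 => (1 + 1 / ‖x‖) * fn Ψ x ^ 2 :=
    ((integrable_sq_fn Ψ).add (integrable_coulomb_sq hΨ)).congr
      (ae_of_all _ fun x => by simp only [Pi.add_apply]; ring)
  have h2 : Integrable fun x : R3 => (1 + 1 / ‖x‖) * fn Φ x ^ 2 :=
    ((integrable_sq_fn Φ).add (integrable_coulomb_sq hΦ)).congr
      (ae_of_all _ fun x => by simp only [Pi.add_apply]; ring)
  refine (h1.add h2).mono' ?_ (ae_of_all _ fun x => ?_)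
  · have := ((memLp_fn Ψ).1.mul (memLp_fn Φ).1).add (aestronglyMeasurable_coulomb Ψ Φ)
    refine this.congr (ae_of_all _ fun x => ?_)
    simp only [Pi.add_apply, Pi.mul_apply]
    ring
  · have hw : 0 ≤ 1 + 1 / ‖x‖ := by positivity
    simp only [Pi.add_apply]
    rw [norm_mul, Real.norm_of_nonneg hw, ← mul_add]
    refine mul_le_mul_of_nonneg_left ?_ hw
    rw [Real.norm_eq_abs, abs_mul]
    nlinarith [sq_nonneg (|fn Ψ x| - |fn Φ x|), sq_abs (fn Ψ x), sq_abs (fn Φ x),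
      sq_nonneg (fn Ψ x), sq_nonneg (fn Φ x)]

theorem integrable_coulomb_mul {Ψ Φ : H1} (hΨ : Ψ ∈ H1rad) (hΦ : Φ ∈ H1rad) :
    Integrable fun x : R3 => 1 / ‖x‖ * fn Ψ x * fn Φ x := by
  refine (integrable_weighted_mul hΨ hΦ).mono ?_ (ae_of_all _ fun x => ?_)
  · simpa only [mul_assoc] using aestronglyMeasurable_coulomb Ψ Φ
  · rw [mul_assoc, norm_mul, norm_mul (1 + 1 / ‖x‖)]
    refine mul_le_mul_of_nonneg_right ?_ (norm_nonneg _)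
    have : 0 ≤ 1 / ‖x‖ := by positivity
    rw [Real.norm_of_nonneg this, Real.norm_of_nonneg (by linarith)]
    linarith

/-! ### The logarithmic nonlinearity -/

theorem le_lnPlus (ξ s : ℝ) : ξ ≤ lnPlus ξ s := by
  unfold lnPlus
  split_ifs
  · exact le_max_right _ _
  · exact le_rfl

theorem monotone_lnPlus (ξ : ℝ) : Monotone (lnPlus ξ) := by
  intro s t hst
  by_cases hs : 0 < s
  · have ht : 0 < t := hs.trans_le hst
    simp only [lnPlus, hs, ht, if_true]
    exact max_le_max_right _ (Real.log_le_log hs hst)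
  · rw [lnPlus, if_neg hs]
    exact le_lnPlus _ _

theorem lnPlus_le_log_one_add {ξ s : ℝ} (hξ : ξ ≤ 0) (hs : 0 ≤ s) :
    lnPlus ξ s ≤ Real.log (1 + s) := by
  have h0 : 0 ≤ Real.log (1 + s) := Real.log_nonneg (by linarith)
  unfold lnPlus
  split_ifs with h
  · exact max_le (Real.log_le_log h (by linarith)) (hξ.trans h0)
  · exact hξ.trans h0

theorem lnPlus_eq_of_le_exp {ξ s : ℝ} (hs : s ≤ Real.exp ξ) : lnPlus ξ s = ξ := by
  unfold lnPlus
  split_ifs with h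
  · exact max_eq_right ((Real.log_le_iff_le_exp h).2 hs)
  · rfl

/-- The scale `κ⁻³ / C_g²` of the argument of the logarithm. -/
def logScale (κ : ℝ) : ℝ := (κ ^ 3)⁻¹ / Cg ^ 2

theorem logScale_pos {κ : ℝ} (hκ : 0 < κ) : 0 < logScale κ := by
  have := Real.pi_pos
  unfold logScale Cg
  positivity

theorem Gprime_eq (κ ξ s : ℝ) :
    Gprime κ ξ s = -κ ^ 2 * lnPlus ξ (logScale κ * s) - 3 * κ ^ 2 := by
  have : (κ ^ 3)⁻¹ * s / Cg ^ 2 = logScale κ * s := by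
    unfold logScale
    ring
  rw [Gprime, this]

theorem antitone_Gprime {κ : ℝ} (hκ : 0 < κ) (ξ : ℝ) : Antitone (Gprime κ ξ) := by
  intro s t hst
  simp only [Gprime_eq]
  have h1 := monotone_lnPlus ξ (mul_le_mul_of_nonneg_left hst (logScale_pos hκ).le)
  nlinarith [mul_le_mul_of_nonneg_left h1 (sq_nonneg κ)]

theorem Gprime_zero (κ ξ : ℝ) : Gprime κ ξ 0 = -κ ^ 2 * (ξ + 3) := by
  rw [Gprime_eq, mul_zero, lnPlus, if_neg (lt_irrefl _)]
  ring

theorem Gprime_le_Gprime_zero (κ ξ s : ℝ) : Gprime κ ξ s ≤ Gprime κ ξ 0 := by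
  rw [Gprime_zero, Gprime_eq]
  nlinarith [mul_le_mul_of_nonneg_left (le_lnPlus ξ (logScale κ * s)) (sq_nonneg κ)]

/-- `G'` tends to `-∞` only logarithmically. -/
theorem le_Gprime {κ ξ s : ℝ} (hκ : 0 < κ) (hξ : ξ ≤ 0) (hs : 0 ≤ s) :
    -κ ^ 2 * (3 + Real.log (1 + logScale κ * s)) ≤ Gprime κ ξ s := by
  rw [Gprime_eq]
  have := lnPlus_le_log_one_add hξ (mul_nonneg (logScale_pos hκ).le hs)
  nlinarith [mul_le_mul_of_nonneg_left this (sq_nonneg κ)]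

/-- The nonlinearity is linear near zero: this is the effect of the truncation of the logarithm. -/
theorem Gprime_eq_Gprime_zero {κ ξ s : ℝ} (hs : logScale κ * s ≤ Real.exp ξ) :
    Gprime κ ξ s = Gprime κ ξ 0 := by
  rw [Gprime_zero, Gprime_eq, lnPlus_eq_of_le_exp hs]
  ring

theorem abs_Gprime_sub_le {κ ξ s : ℝ} (hκ : 0 < κ) (hξ : ξ ≤ 0) (hs : 0 ≤ s) :
    |Gprime κ ξ s - Gprime κ ξ 0| ≤ κ ^ 2 * (-ξ + logScale κ * s) := by
  have hc : 0 ≤ logScale κ * s := mul_nonneg (logScale_pos hκ).le hs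
  have h1 := le_Gprime hκ hξ hs
  have h2 : Real.log (1 + logScale κ * s) ≤ logScale κ * s := by
    have := Real.log_le_sub_one_of_pos (show 0 < 1 + logScale κ * s by linarith)
    linarith
  have h3 := Gprime_le_Gprime_zero κ ξ s
  rw [abs_sub_comm, abs_of_nonneg (by linarith)]
  rw [Gprime_zero] at *
  nlinarith [mul_le_mul_of_nonneg_left h2 (sq_nonneg κ)]

theorem measurable_Gprime {κ : ℝ} (hκ : 0 < κ) (ξ : ℝ) : Measurable (Gprime κ ξ) :=
  (antitone_Gprime hκ ξ).measurable

theorem intervalIntegrable_Gprime {κ : ℝ} (hκ : 0 < κ) (ξ a b : ℝ) :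
    IntervalIntegrable (Gprime κ ξ) volume a b :=
  (antitone_Gprime hκ ξ).intervalIntegrable

theorem measurable_G {κ : ℝ} (hκ : 0 < κ) (ξ : ℝ) : Measurable (G κ ξ) :=
  (intervalIntegral.continuous_primitive (intervalIntegrable_Gprime hκ ξ) 0).measurable

/-- `G` is concave on `[0, ∞)` and vanishes at zero. -/
theorem mul_Gprime_le_G {κ : ℝ} (hκ : 0 < κ) (ξ : ℝ) {s : ℝ} (hs : 0 ≤ s) :
    s * Gprime κ ξ s ≤ G κ ξ s := by
  have h := intervalIntegral.integral_mono_on hs (μ := volume)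
    (f := fun _ => Gprime κ ξ s) (by simp)
    (intervalIntegrable_Gprime hκ ξ 0 s) (fun t ht => antitone_Gprime hκ ξ ht.2)
  simpa [G] using h

theorem G_le_mul_Gprime_zero {κ : ℝ} (hκ : 0 < κ) (ξ : ℝ) {s : ℝ} (hs : 0 ≤ s) :
    G κ ξ s ≤ s * Gprime κ ξ 0 := by
  have h := intervalIntegral.integral_mono_on hs (μ := volume)
    (g := fun _ => Gprime κ ξ 0) (intervalIntegrable_Gprime hκ ξ 0 s) (by simp)
    (fun t ht => Gprime_le_Gprime_zero κ ξ t)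
  simpa [G] using h

/-! ### Energy and residual on radial functions -/

/-- For radial `u` the potential `G'(|u|²)` is at most as singular as `1 / |x|`. -/
theorem exists_abs_Gprime_le {κ ξ : ℝ} (hκ : 0 < κ) (hξ : ξ ≤ 0) {Ψ : H1} (hΨ : Ψ ∈ H1rad) :
    ∃ C : ℝ, 0 ≤ C ∧ ∀ᵐ x : R3, |Gprime κ ξ (|fn Ψ x| ^ 2)| ≤ C * (1 + 1 / ‖x‖) := by
  have hγ := sphereArea_pos
  have hc := logScale_pos hκ
  set K := ‖Ψ.1.snd‖ ^ 2 / sphereArea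
  have hK : 0 ≤ K := by positivity
  refine ⟨|Gprime κ ξ 0| + κ ^ 2 * (-ξ + logScale κ * K), by
    have : 0 ≤ -ξ := by linarith
    positivity, ?_⟩
  filter_upwards [sq_fn_le_of_radial hΨ] with x hx
  have h1 := abs_Gprime_sub_le hκ hξ (sq_nonneg (|fn Ψ x|))
  have h2 := abs_sub_abs_le_abs_sub (Gprime κ ξ (|fn Ψ x| ^ 2)) (Gprime κ ξ 0)
  have hn : 0 ≤ 1 / ‖x‖ := by positivity
  rw [sq_abs] at *
  have h3 := mul_le_mul_of_nonneg_left (mul_le_mul_of_nonneg_left hx hc.le) (sq_nonneg κ)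
  have h4 : 0 ≤ |Gprime κ ξ 0| * (1 / ‖x‖) := by positivity
  have h5 : 0 ≤ κ ^ 2 * (-ξ) * (1 / ‖x‖) :=
    mul_nonneg (mul_nonneg (sq_nonneg κ) (by linarith)) hn
  have h6 : 0 ≤ κ ^ 2 * (logScale κ * K) := by positivity
  have h7 : (|Gprime κ ξ 0| + κ ^ 2 * (-ξ + logScale κ * K)) * (1 + 1 / ‖x‖) =
    |Gprime κ ξ 0| + κ ^ 2 * (-ξ) + κ ^ 2 * (logScale κ * (K * (1 / ‖x‖))) +
    |Gprime κ ξ 0| * (1 / ‖x‖) + κ ^ 2 * (-ξ) * (1 / ‖x‖) + κ ^ 2 * (logScale κ * K) := by ring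
  rw [h7]
  linarith

theorem aestronglyMeasurable_Gprime {κ : ℝ} (hκ : 0 < κ) (ξ : ℝ) (Ψ : H1) :
    AEStronglyMeasurable fun x => Gprime κ ξ (|fn Ψ x| ^ 2) := by
  refine ((measurable_Gprime hκ ξ).comp_aemeasurable ?_).aestronglyMeasurable
  simp only [sq_abs]
  exact (memLp_fn Ψ).1.aemeasurable.pow_const 2

theorem integrable_g_mul {κ ξ : ℝ} (hκ : 0 < κ) (hξ : ξ ≤ 0) {Ψ Φ : H1} (hΨ : Ψ ∈ H1rad)
    (hΦ : Φ ∈ H1rad) : Integrable fun x => g κ ξ (fn Ψ x) * fn Φ x := by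
  obtain ⟨C, hC, hCb⟩ := exists_abs_Gprime_le hκ hξ hΨ
  refine ((integrable_weighted_mul hΨ hΦ).norm.const_mul C).mono' ?_ ?_
  · exact ((aestronglyMeasurable_Gprime hκ ξ Ψ).mul (memLp_fn Ψ).1).mul (memLp_fn Φ).1
  · filter_upwards [hCb] with x hx
    have hw : 0 ≤ 1 + 1 / ‖x‖ := by positivity
    rw [g, mul_assoc, norm_mul, norm_mul (1 + 1 / ‖x‖), Real.norm_of_nonneg hw, ← mul_assoc]
    exact mul_le_mul_of_nonneg_right hx (norm_nonneg _)

theorem integrable_G {κ ξ : ℝ} (hκ : 0 < κ) (hξ : ξ ≤ 0) {Ψ : H1} (hΨ : Ψ ∈ H1rad) :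
    Integrable fun x => G κ ξ (|fn Ψ x| ^ 2) := by
  refine ((integrable_g_mul hκ hξ hΨ hΨ).norm.add
    ((integrable_sq_fn Ψ).mul_const (Gprime κ ξ 0)).norm).mono' ?_ (ae_of_all _ fun x => ?_)
  · refine ((measurable_G hκ ξ).comp_aemeasurable ?_).aestronglyMeasurable
    simp only [sq_abs]
    exact (memLp_fn Ψ).1.aemeasurable.pow_const 2
  · have h1 := mul_Gprime_le_G hκ ξ (sq_nonneg |fn Ψ x|)
    have h2 := G_le_mul_Gprime_zero hκ ξ (sq_nonneg |fn Ψ x|)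
    have h3 : g κ ξ (fn Ψ x) * fn Ψ x = |fn Ψ x| ^ 2 * Gprime κ ξ (|fn Ψ x| ^ 2) := by
      rw [g, sq_abs]
      ring
    simp only [Pi.add_apply, Real.norm_eq_abs]
    rw [h3, ← sq_abs (fn Ψ x)]
    refine abs_le.2 ⟨?_, ?_⟩
    · linarith [neg_abs_le (|fn Ψ x| ^ 2 * Gprime κ ξ (|fn Ψ x| ^ 2)),
        abs_nonneg (|fn Ψ x| ^ 2 * Gprime κ ξ 0)]
    · linarith [le_abs_self (|fn Ψ x| ^ 2 * Gprime κ ξ 0),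
        abs_nonneg (|fn Ψ x| ^ 2 * Gprime κ ξ (|fn Ψ x| ^ 2))]

theorem energyZero_eq {Ψ : H1} (hΨ : Ψ ∈ H1rad) :
    energyZero Ψ = 1 / 2 * ‖Ψ.1.snd‖ ^ 2 - ∫ x, 1 / ‖x‖ * fn Ψ x ^ 2 := by
  have h1 : Integrable fun x => ‖grad Ψ x‖ ^ 2 :=
    (memLp_two_iff_integrable_sq_norm (memLp_grad Ψ).1).1 (memLp_grad Ψ)
  unfold energyZero
  simp only [sq_abs]
  rw [integral_sub (h1.const_mul _) (integrable_coulomb_sq hΨ), integral_const_mul,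
    integral_sq_grad]

/-- Concavity of `G` turns the energy into a bound on the nonlinear term of the equation. -/
theorem integral_g_mul_self_le {κ ξ : ℝ} (hκ : 0 < κ) (hξ : ξ ≤ 0) {Ψ : H1} (hΨ : Ψ ∈ H1rad) :
    1 / 2 * ∫ x, g κ ξ (fn Ψ x) * fn Ψ x ≤ energyNonlin κ ξ Ψ := by
  unfold energyNonlin
  refine mul_le_mul_of_nonneg_left ?_ (by norm_num)
  refine integral_mono (integrable_g_mul hκ hξ hΨ hΨ) (integrable_G hκ hξ hΨ) fun x => ?_
  refine le_of_eq_of_le ?_ (mul_Gprime_le_G hκ ξ (sq_nonneg |fn Ψ x|))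
  simp only [g, sq_abs]
  ring

/-- Pointwise decay makes the logarithm harmless: `-∫ g(u) u` is controlled by the Coulomb energy
and the logarithm of the kinetic energy. -/
theorem le_integral_g_mul_self {κ ξ : ℝ} (hκ : 0 < κ) (hξ : ξ ≤ 0) {Ψ : H1} (hΨ : Ψ ∈ H1rad) :
    -κ ^ 2 * ((3 + Real.log (1 + logScale κ * (‖Ψ.1.snd‖ ^ 2 / sphereArea))) * ‖Ψ.1.fst‖ ^ 2 +
      ∫ x, 1 / ‖x‖ * fn Ψ x ^ 2) ≤ ∫ x, g κ ξ (fn Ψ x) * fn Ψ x := by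
  have hγ := sphereArea_pos
  have hc := logScale_pos hκ
  set K := ‖Ψ.1.snd‖ ^ 2 / sphereArea
  have hK : 0 ≤ K := by positivity
  rw [← integral_sq_fn, ← integral_const_mul, ← integral_add
    ((integrable_sq_fn Ψ).const_mul _) (integrable_coulomb_sq hΨ), ← integral_const_mul]
  refine integral_mono_ae ((((integrable_sq_fn Ψ).const_mul _).add
    (integrable_coulomb_sq hΨ)).const_mul _) (integrable_g_mul hκ hξ hΨ hΨ) ?_
  filter_upwards [sq_fn_le_of_radial hΨ, ae_ne_zero_R3] with x hx hx0
  have hn : 0 < ‖x‖ := norm_pos_iff.2 hx0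
  have h1 := le_Gprime hκ hξ (sq_nonneg |fn Ψ x|)
  have hlog : Real.log (1 + logScale κ * fn Ψ x ^ 2) ≤
      Real.log (1 + logScale κ * K) + 1 / ‖x‖ := by
    have h2 : 1 + logScale κ * fn Ψ x ^ 2 ≤ (1 + logScale κ * K) * (1 + 1 / ‖x‖) := by
      have h3 := mul_le_mul_of_nonneg_left hx hc.le
      have h4 : 0 ≤ 1 / ‖x‖ := by positivity
      have h5 : 0 ≤ logScale κ * K := by positivity
      nlinarith
    have h6 := Real.log_le_log (by positivity) h2
    rw [Real.log_mul (by positivity) (by positivity)] at h6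
    have h7 := Real.log_le_sub_one_of_pos (show 0 < 1 + 1 / ‖x‖ by positivity)
    linarith
  rw [g, mul_assoc, ← sq]
  rw [sq_abs] at h1 ⊢
  have h8 := mul_le_mul_of_nonneg_right h1 (sq_nonneg (fn Ψ x))
  have h9 := mul_le_mul_of_nonneg_left hlog (mul_nonneg (sq_nonneg κ) (sq_nonneg (fn Ψ x)))
  nlinarith

/-- An energy bound controls the kinetic energy. -/
theorem exists_kinetic_bound {κ ξ : ℝ} (hκ : 0 < κ) (hξ : ξ ≤ 0) :
    ∃ M : ℝ, ∀ Ψ ∈ XiRad, energy κ ξ Ψ ≤ 0 → ‖Ψ.1.snd‖ ^ 2 ≤ M := by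
  have hγ := sphereArea_pos
  have hc := logScale_pos hκ
  -- `ρ` and `δ` are chosen so that the Coulomb and the logarithmic term each absorb an eighth of
  -- the kinetic energy
  obtain ⟨ρ, hρ, hρe⟩ : ∃ ρ : ℝ, 0 < ρ ∧ (1 + κ ^ 2 / 2) * ρ = 1 / 8 :=
    ⟨1 / 8 / (1 + κ ^ 2 / 2), by positivity, by field_simp⟩
  obtain ⟨δ, hδ, hδe⟩ : ∃ δ : ℝ, 0 < δ ∧ κ ^ 2 / 2 * (δ * (logScale κ / sphereArea)) = 1 / 8 :=
    ⟨1 / 8 / (κ ^ 2 / 2 * (logScale κ / sphereArea)), by positivity, by field_simp⟩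
  set B := (1 + κ ^ 2 / 2) * (1 / ρ) + κ ^ 2 / 2 * (3 + δ - 1 - Real.log δ) with hB
  refine ⟨4 * B, ?_⟩
  rintro Ψ ⟨hΨ, hnorm⟩ hE
  simp only [sq_abs] at hnorm
  rw [integral_sq_fn] at hnorm
  have h1 := le_integral_g_mul_self hκ hξ hΨ
  have h2 := integral_g_mul_self_le hκ hξ hΨ
  have h3 := integral_coulomb_le hΨ hρ
  rw [energy, energyZero_eq hΨ] at hE
  rw [hnorm] at h1 h3
  set T := ‖Ψ.1.snd‖ ^ 2
  have hT0 : 0 ≤ T := sq_nonneg _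
  set Q := ∫ x, 1 / ‖x‖ * fn Ψ x ^ 2
  set ℓ := Real.log (1 + logScale κ * (T / sphereArea))
  have hlog : ℓ ≤ δ * (1 + logScale κ * (T / sphereArea)) - 1 - Real.log δ := by
    have hpos : 0 < 1 + logScale κ * (T / sphereArea) := by positivity
    have h4 := Real.log_le_sub_one_of_pos (mul_pos hδ hpos)
    rw [Real.log_mul hδ.ne' hpos.ne'] at h4
    linarith
  have h5 := mul_le_mul_of_nonneg_left hlog (show 0 ≤ κ ^ 2 / 2 by positivity)
  have h6 := mul_le_mul_of_nonneg_left h3 (show 0 ≤ 1 + κ ^ 2 / 2 by positivity)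
  have h7 : (1 + κ ^ 2 / 2) * (ρ * T + 1 / ρ * 1) = 1 / 8 * T + (1 + κ ^ 2 / 2) * (1 / ρ) := by
    rw [← hρe]
    ring
  have h8 : κ ^ 2 / 2 * (δ * (1 + logScale κ * (T / sphereArea)) - 1 - Real.log δ) =
      1 / 8 * T + κ ^ 2 / 2 * (δ - 1 - Real.log δ) := by
    rw [← hδe]
    ring
  have h9 : 1 / 2 * (-κ ^ 2 * ((3 + ℓ) * 1 + Q)) =
    -(3 * (κ ^ 2 / 2)) - κ ^ 2 / 2 * ℓ - κ ^ 2 / 2 * Q := by ring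
  have h10 : B = (1 + κ ^ 2 / 2) * (1 / ρ) + 3 * (κ ^ 2 / 2) +
      κ ^ 2 / 2 * (δ - 1 - Real.log δ) := by
    rw [hB]
    ring
  linarith

/-! ### Compactness of bounded radial sequences -/

/-- The Hölder bound for the profile, restated for the function itself on a set of full measure. -/
theorem exists_holder_set {Ψ : H1} (hΨ : Ψ ∈ H1rad) :
    ∃ X : Set R3, (∀ᵐ x, x ∈ X) ∧ ∀ x ∈ X, ∀ y ∈ X,
      (fn Ψ x - fn Ψ y) ^ 2 ≤ ‖Ψ.1.snd‖ ^ 2 / sphereArea * |1 / ‖x‖ - 1 / ‖y‖| := by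
  obtain ⟨f, hfm, hf⟩ : IsRadial (fn Ψ) := hΨ
  obtain ⟨S, hS, hSf⟩ :=
    sq_profile_sub_le (isWeakGradient_grad Ψ) (memLp_fn Ψ) (memLp_grad Ψ) hfm hf
  rw [integral_sq_grad] at hSf
  have hγ := sphereArea_pos
  refine ⟨{x | fn Ψ x = f ‖x‖ ∧ ‖x‖ ∈ S ∧ x ≠ 0}, ?_, ?_⟩
  · filter_upwards [hf, ae_norm_of_ae hS, ae_ne_zero_R3] with x h1 h2 h3 using ⟨h1, h2, h3⟩
  · have key : ∀ r ∈ S, ∀ s ∈ S, 0 < r → r ≤ s →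
        (f r - f s) ^ 2 ≤ ‖Ψ.1.snd‖ ^ 2 / sphereArea * |1 / r - 1 / s| := by
      intro r hr s hs hr0 hrs
      rw [div_mul_eq_mul_div, le_div_iff₀ hγ, mul_comm]
      refine (hSf r hr s hs hr0 hrs).trans ?_
      rw [mul_comm]
      exact mul_le_mul_of_nonneg_left (le_abs_self _) (sq_nonneg _)
    rintro x ⟨hx, hxS, hx0⟩ y ⟨hy, hyS, hy0⟩
    rw [hx, hy]
    rcases le_total ‖x‖ ‖y‖ with h | h
    · exact key _ hxS _ hyS (norm_pos_iff.2 hx0) h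
    · rw [← neg_sub (f ‖y‖), neg_sq, abs_sub_comm]
      exact key _ hyS _ hxS (norm_pos_iff.2 hy0) h

/-- A bounded sequence of radial `H¹` functions has a subsequence converging almost everywhere:
a diagonal argument on a countable dense set, with equicontinuity supplied by the Hölder bound. -/
theorem exists_subseq_tendsto_ae {Ψ : ℕ → H1} (hΨ : ∀ j, Ψ j ∈ H1rad) {M : ℝ}
    (hM : ∀ j, ‖(Ψ j).1.snd‖ ^ 2 ≤ M) :
    ∃ n : ℕ → ℕ, StrictMono n ∧
      ∀ᵐ x, ∃ l, Tendsto (fun k => fn (Ψ (n k)) x) atTop (𝓝 l) := by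
  have hγ := sphereArea_pos
  choose X hX hXh using fun j => exists_holder_set (hΨ j)
  set K := M / sphereArea with hK
  have hMK : ∀ j, ‖(Ψ j).1.snd‖ ^ 2 / sphereArea ≤ K := fun j => by
    rw [hK]
    gcongr
    exact hM j
  set Z : Set R3 := {x | x ≠ 0 ∧ ∀ j, x ∈ X j ∧ fn (Ψ j) x ^ 2 ≤ K * (1 / ‖x‖)}
  have hZae : ∀ᵐ x, x ∈ Z := by
    filter_upwards [ae_ne_zero_R3, ae_all_iff.2 hX,
      ae_all_iff.2 fun j => sq_fn_le_of_radial (hΨ j)] with x h0 h1 h2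
    exact ⟨h0, fun j => ⟨h1 j, (h2 j).trans
      (mul_le_mul_of_nonneg_right (hMK j) (by positivity))⟩⟩
  -- on a countable dense subset `D` of the good set `Z`, sequential compactness of a product of
  -- countably many intervals gives pointwise convergence of a subsequence
  obtain ⟨D, hDc, hDd⟩ := TopologicalSpace.exists_countable_dense Z
  have : Countable D := hDc.to_subtype
  have hcomp : IsCompact (Set.pi Set.univ fun q : D =>
      Set.Icc (-(1 + K * (1 / ‖(q : Z).1‖))) (1 + K * (1 / ‖(q : Z).1‖))) :=
    isCompact_univ_pi fun _ => isCompact_Icc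
  obtain ⟨a, -, n, hn, hlim⟩ := hcomp.tendsto_subseq
    (x := fun j (q : D) => fn (Ψ j) (q : Z).1) (by
      intro j q _
      have := ((q : Z).2.2 j).2
      refine Set.mem_Icc.2 (abs_le.1 ?_)
      nlinarith [sq_abs (fn (Ψ j) (q : Z).1), sq_nonneg (|fn (Ψ j) (q : Z).1| - 1)])
  rw [tendsto_pi_nhds] at hlim
  refine ⟨n, hn, ?_⟩
  filter_upwards [hZae] with x hx
  refine cauchySeq_tendsto_of_complete (Metric.cauchySeq_iff.2 fun ε hε => ?_)
  have hcont : ContinuousAt (fun y : R3 => K * |1 / ‖x‖ - 1 / ‖y‖|) x := by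
    have h1 : ContinuousAt (fun y : R3 => 1 / ‖y‖) x :=
      continuousAt_const.div continuous_norm.continuousAt (norm_ne_zero_iff.2 hx.1)
    exact continuousAt_const.mul (continuousAt_const.sub h1).abs
  have hev : ∀ᶠ y in 𝓝 x, K * |1 / ‖x‖ - 1 / ‖y‖| < (ε / 4) ^ 2 := by
    refine hcont.eventually (gt_mem_nhds ?_)
    simp only [sub_self, abs_zero, mul_zero]
    positivity
  -- transfer to `x` from a point `q ∈ D` whose norm is close to that of `x`
  obtain ⟨q, hqD, hq⟩ := hDd.inter_nhds_nonempty
    (continuous_subtype_val.continuousAt.preimage_mem_nhds (x := (⟨x, hx⟩ : Z)) hev)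
  have hq' : K * |1 / ‖x‖ - 1 / ‖q.1‖| < (ε / 4) ^ 2 := hq
  obtain ⟨N, hN⟩ := Metric.cauchySeq_iff.1 (hlim ⟨q, hqD⟩).cauchySeq (ε / 2) (by positivity)
  refine ⟨N, fun j hj k hk => ?_⟩
  have h1 : ∀ i, |fn (Ψ i) x - fn (Ψ i) q.1| < ε / 4 := fun i => by
    refine abs_lt_of_sq_lt_sq ?_ (by positivity)
    refine lt_of_le_of_lt (hXh i x (hx.2 i).1 q.1 (q.2.2 i).1) (lt_of_le_of_lt ?_ hq')
    exact mul_le_mul_of_nonneg_right (hMK i) (abs_nonneg _)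
  have h2 := hN j hj k hk
  simp only [Function.comp_apply, Real.dist_eq] at h2 ⊢
  have h3 := abs_lt.1 (h1 (n j))
  have h4 := abs_lt.1 (h1 (n k))
  have h5 := abs_lt.1 h2
  exact abs_lt.2 ⟨by linarith, by linarith⟩

/-! ### The difference of two residuals -/

/-- The part of `g` that is left after subtracting its linearization `G'(0) ψ` at zero. -/
def excess (κ ξ ψ : ℝ) : ℝ := (Gprime κ ξ (|ψ| ^ 2) - Gprime κ ξ 0) * ψ

theorem g_eq_add_excess (κ ξ ψ : ℝ) : g κ ξ ψ = Gprime κ ξ 0 * ψ + excess κ ξ ψ := by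
  unfold g excess
  ring

theorem excess_eq_zero {κ ξ ψ : ℝ} (h : logScale κ * ψ ^ 2 ≤ Real.exp ξ) : excess κ ξ ψ = 0 := by
  unfold excess
  rw [sq_abs, Gprime_eq_Gprime_zero h, sub_self, zero_mul]

theorem abs_excess_le {κ ξ : ℝ} (hκ : 0 < κ) (hξ : ξ ≤ 0) {ψ s : ℝ} (h : ψ ^ 2 ≤ s) :
    |excess κ ξ ψ| ≤ κ ^ 2 * (-ξ + logScale κ * s) * |ψ| := by
  unfold excess
  rw [sq_abs, abs_mul]
  refine mul_le_mul_of_nonneg_right ?_ (abs_nonneg _)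
  refine (abs_Gprime_sub_le hκ hξ (sq_nonneg ψ)).trans ?_
  have := mul_le_mul_of_nonneg_left h (logScale_pos hκ).le
  exact mul_le_mul_of_nonneg_left (by linarith) (sq_nonneg κ)

theorem integrable_excess_mul {κ ξ : ℝ} (hκ : 0 < κ) (hξ : ξ ≤ 0) {Ψ Φ : H1} (hΨ : Ψ ∈ H1rad)
    (hΦ : Φ ∈ H1rad) : Integrable fun x => excess κ ξ (fn Ψ x) * fn Φ x := by
  refine ((integrable_g_mul hκ hξ hΨ hΦ).sub
    (((memLp_fn Ψ).integrable_mul (memLp_fn Φ)).const_mul (Gprime κ ξ 0))).congr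
    (ae_of_all _ fun x => ?_)
  simp only [Pi.sub_apply, Pi.mul_apply, g_eq_add_excess]
  ring

/-- The compact part of the difference of two residuals: Coulomb and nonlinear terms in a ball. -/
def localDefect (κ ξ R : ℝ) (Ψ Φ : H1) : R3 → ℝ :=
  (Metric.ball (0 : R3) R).indicator fun x => 1 / ‖x‖ * (fn Ψ x - fn Φ x) ^ 2 +
    1 / 2 * |(excess κ ξ (fn Ψ x) - excess κ ξ (fn Φ x)) * (fn Ψ x - fn Φ x)|

theorem integrable_excess_sub_mul {κ ξ : ℝ} (hκ : 0 < κ) (hξ : ξ ≤ 0) {Ψ Φ : H1}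
    (hΨ : Ψ ∈ H1rad) (hΦ : Φ ∈ H1rad) : Integrable fun x =>
      (excess κ ξ (fn Ψ x) - excess κ ξ (fn Φ x)) * (fn Ψ x - fn Φ x) := by
  have hd := H1rad.sub_mem hΨ hΦ
  refine ((integrable_excess_mul hκ hξ hΨ hd).sub (integrable_excess_mul hκ hξ hΦ hd)).congr ?_
  filter_upwards [fn_sub_ae Ψ Φ] with x hx
  simp only [Pi.sub_apply, hx]
  ring

theorem integrable_coulomb_sub_sq {Ψ Φ : H1} (hΨ : Ψ ∈ H1rad) (hΦ : Φ ∈ H1rad) :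
    Integrable fun x : R3 => 1 / ‖x‖ * (fn Ψ x - fn Φ x) ^ 2 := by
  refine (integrable_coulomb_sq (H1rad.sub_mem hΨ hΦ)).congr ?_
  filter_upwards [fn_sub_ae Ψ Φ] with x hx
  rw [hx]

theorem integrable_localDefect {κ ξ : ℝ} (hκ : 0 < κ) (hξ : ξ ≤ 0) (R : ℝ) {Ψ Φ : H1}
    (hΨ : Ψ ∈ H1rad) (hΦ : Φ ∈ H1rad) : Integrable (localDefect κ ξ R Ψ Φ) :=
  ((integrable_coulomb_sub_sq hΨ hΦ).add
    ((integrable_excess_sub_mul hκ hξ hΨ hΦ).abs.const_mul _)).indicator measurableSet_ball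

theorem inner_sub_self_right_eq {E : Type*} [NormedAddCommGroup E] [InnerProductSpace ℝ E]
    (x y : E) : inner ℝ x (x - y) = ‖x - y‖ ^ 2 + inner ℝ y (x - y) := by
  rw [← real_inner_self_eq_norm_sq, ← inner_add_left, sub_add_cancel]

/-- The difference of two residuals tested with `D = Ψ - Φ`. Only the linearization `G'(0)` of the
nonlinearity enters the quadratic form in `D`; the rest of the nonlinearity appears as `excess`. -/
theorem residual_sub_eq {κ ξ : ℝ} (hκ : 0 < κ) (hξ : ξ ≤ 0) {Ψ Φ D : H1} (hΨ : Ψ ∈ H1rad)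
    (hΦ : Φ ∈ H1rad) (hD : D = Ψ - Φ) (ω ω' : ℝ) :
    residual κ ξ ω Ψ D - residual κ ξ ω' Φ D =
      (ω - 1 / 2 * Gprime κ ξ 0) * ‖D.1.fst‖ ^ 2 +
      (ω - ω') * inner ℝ Φ.1.fst D.1.fst - 1 / 2 * ‖D.1.snd‖ ^ 2 +
      ∫ x, (1 / ‖x‖ * (fn Ψ x - fn Φ x) ^ 2 -
        1 / 2 * ((excess κ ξ (fn Ψ x) - excess κ ξ (fn Φ x)) * (fn Ψ x - fn Φ x))) := by
  have hd : D ∈ H1rad := hD ▸ H1rad.sub_mem hΨ hΦ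
  have hae : ∀ᵐ x, fn D x = fn Ψ x - fn Φ x := hD ▸ fn_sub_ae Ψ Φ
  have hD1 : D.1.fst = Ψ.1.fst - Φ.1.fst := by rw [hD]; rfl
  have hD2 : D.1.snd = Ψ.1.snd - Φ.1.snd := by rw [hD]; rfl
  have h1 : inner ℝ Ψ.1.fst D.1.fst = ‖D.1.fst‖ ^ 2 + inner ℝ Φ.1.fst D.1.fst := by
    rw [hD1]
    exact inner_sub_self_right_eq _ _
  have h2 : inner ℝ Ψ.1.snd D.1.snd = ‖D.1.snd‖ ^ 2 + inner ℝ Φ.1.snd D.1.snd := by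
    rw [hD2]
    exact inner_sub_self_right_eq _ _
  clear hD hD1 hD2
  have hg : ∀ {Θ : H1}, Θ ∈ H1rad → ∫ x, g κ ξ (fn Θ x) * fn D x =
      Gprime κ ξ 0 * inner ℝ Θ.1.fst D.1.fst +
        ∫ x, excess κ ξ (fn Θ x) * fn D x := by
    intro Θ hΘ
    have hi : Integrable fun x => fn Θ x * fn D x :=
      (memLp_fn Θ).integrable_mul (memLp_fn D)
    rw [← integral_fn_mul, ← integral_const_mul, ← integral_add (hi.const_mul _)
      (integrable_excess_mul hκ hξ hΘ hd)]
    refine integral_congr_ae (ae_of_all _ fun x => ?_)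
    simp only [g_eq_add_excess]
    ring
  have hC : ∫ x, 1 / ‖x‖ * (fn Ψ x - fn Φ x) ^ 2 =
      (∫ x, 1 / ‖x‖ * fn Ψ x * fn D x) - ∫ x, 1 / ‖x‖ * fn Φ x * fn D x := by
    rw [← integral_sub (integrable_coulomb_mul hΨ hd) (integrable_coulomb_mul hΦ hd)]
    refine integral_congr_ae ?_
    filter_upwards [hae] with x hx
    rw [hx]
    ring
  have hE : ∫ x, (excess κ ξ (fn Ψ x) - excess κ ξ (fn Φ x)) * (fn Ψ x - fn Φ x) =
      (∫ x, excess κ ξ (fn Ψ x) * fn D x) - ∫ x, excess κ ξ (fn Φ x) * fn D x := by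
    rw [← integral_sub (integrable_excess_mul hκ hξ hΨ hd) (integrable_excess_mul hκ hξ hΦ hd)]
    refine integral_congr_ae ?_
    filter_upwards [hae] with x hx
    rw [hx]
    ring
  rw [integral_sub (integrable_coulomb_sub_sq hΨ hΦ)
    ((integrable_excess_sub_mul hκ hξ hΨ hΦ).const_mul _), integral_const_mul, hC, hE]
  have hr : ∀ {Θ : H1} (hΘ : Θ ∈ H1rad) (ω : ℝ), residual κ ξ ω Θ D =
      ω * inner ℝ Θ.1.fst D.1.fst - 1 / 2 * inner ℝ Θ.1.snd D.1.snd +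
        (∫ x, 1 / ‖x‖ * fn Θ x * fn D x) - 1 / 2 * (Gprime κ ξ 0 * inner ℝ Θ.1.fst D.1.fst +
        ∫ x, excess κ ξ (fn Θ x) * fn D x) := by
    intro Θ hΘ ω
    rw [← hg hΘ, ← integral_fn_mul, ← integral_inner_grad]
    rfl
  linear_combination hr hΨ ω - hr hΦ ω' + (ω - 1 / 2 * Gprime κ ξ 0) * h1 - 1 / 2 * h2

/-- Coercivity of the linearization at zero: outside a large ball the nonlinearity is linear and
the Coulomb potential is at most `1 / R`. -/
theorem norm_sub_le_residual_sub {κ ξ : ℝ} (hκ : 0 < κ) (hξ : ξ ≤ 0) {Ψ Φ : H1}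
    (hΨ : Ψ ∈ H1rad) (hΦ : Φ ∈ H1rad) (ω ω' : ℝ) {M R : ℝ} (hR : 0 < R)
    (hMΨ : ‖Ψ.1.snd‖ ^ 2 ≤ M) (hMΦ : ‖Φ.1.snd‖ ^ 2 ≤ M)
    (hRM : logScale κ * (M / sphereArea * (1 / R)) ≤ Real.exp ξ) :
    (1 / 2 * Gprime κ ξ 0 - ω - 1 / R) * ‖(Ψ - Φ).1.fst‖ ^ 2 + 1 / 2 * ‖(Ψ - Φ).1.snd‖ ^ 2 ≤
      residual κ ξ ω' Φ (Ψ - Φ) - residual κ ξ ω Ψ (Ψ - Φ) +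
      (ω - ω') * inner ℝ Φ.1.fst (Ψ - Φ).1.fst + ∫ x, localDefect κ ξ R Ψ Φ x := by
  have hγ := sphereArea_pos
  have hM : 0 ≤ M := (sq_nonneg _).trans hMΨ
  have hfar : ∀ {Θ : H1}, Θ ∈ H1rad → ‖Θ.1.snd‖ ^ 2 ≤ M →
      ∀ᵐ x : R3, x ∉ Metric.ball (0 : R3) R → excess κ ξ (fn Θ x) = 0 := by
    intro Θ hΘ hMΘ
    filter_upwards [sq_fn_le_of_radial hΘ] with x hx hxR
    refine excess_eq_zero (le_trans ?_ hRM)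
    refine mul_le_mul_of_nonneg_left (hx.trans ?_) (logScale_pos hκ).le
    have hxR' : R ≤ ‖x‖ := by simpa using hxR
    gcongr
  have hint : ∫ x, (1 / ‖x‖ * (fn Ψ x - fn Φ x) ^ 2 -
      1 / 2 * ((excess κ ξ (fn Ψ x) - excess κ ξ (fn Φ x)) * (fn Ψ x - fn Φ x))) ≤
      (∫ x, localDefect κ ξ R Ψ Φ x) + 1 / R * ‖(Ψ - Φ).1.fst‖ ^ 2 := by
    rw [← integral_sq_fn, ← integral_const_mul, ← integral_add
      (integrable_localDefect hκ hξ R hΨ hΦ) ((integrable_sq_fn _).const_mul _)]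
    refine integral_mono_ae ((integrable_coulomb_sub_sq hΨ hΦ).sub
      ((integrable_excess_sub_mul hκ hξ hΨ hΦ).const_mul _))
      ((integrable_localDefect hκ hξ R hΨ hΦ).add ((integrable_sq_fn _).const_mul _)) ?_
    filter_upwards [hfar hΨ hMΨ, hfar hΦ hMΦ, fn_sub_ae Ψ Φ] with x h1 h2 h3
    simp only [h3, localDefect]
    by_cases hx : x ∈ Metric.ball (0 : R3) R
    · rw [Set.indicator_of_mem hx]
      have h4 : 0 ≤ 1 / R * (fn Ψ x - fn Φ x) ^ 2 := by positivity
      have h5 := neg_abs_le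
        ((excess κ ξ (fn Ψ x) - excess κ ξ (fn Φ x)) * (fn Ψ x - fn Φ x))
      linarith
    · rw [Set.indicator_of_notMem hx, h1 hx, h2 hx, sub_self, zero_mul, mul_zero, sub_zero,
        zero_add]
      refine mul_le_mul_of_nonneg_right ?_ (sq_nonneg _)
      exact one_div_le_one_div_of_le hR (by simpa using hx)
  have := residual_sub_eq hκ hξ hΨ hΦ rfl ω ω'
  linarith

/-- If `u², v² ≤ K / r` and `r ≤ R`, the integrand of the local defect is `O(1 / r²)`. -/
theorem defect_le {κ ξ K R r u v : ℝ} (hκ : 0 < κ) (hξ : ξ ≤ 0) (hK : 0 ≤ K) (hr : 0 < r)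
    (hrR : r ≤ R) (hu : u ^ 2 ≤ K * (1 / r)) (hv : v ^ 2 ≤ K * (1 / r)) :
    1 / r * (u - v) ^ 2 + 1 / 2 * |(excess κ ξ u - excess κ ξ v) * (u - v)| ≤
      (4 * K + 2 * K * κ ^ 2 * (-ξ * R + logScale κ * K)) * (1 / r ^ 2) := by
  have hc := logScale_pos hκ
  have hξ' : 0 ≤ -ξ := by linarith
  have heu := abs_excess_le hκ hξ hu
  have hev := abs_excess_le hκ hξ hv
  set A := κ ^ 2 * (-ξ + logScale κ * (K * (1 / r))) with hA
  have hA0 : 0 ≤ A := by positivity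
  have huv : (|u| + |v|) ^ 2 ≤ 4 * (K * (1 / r)) := by
    have := add_sq_le (a := |u|) (b := |v|)
    rw [sq_abs, sq_abs] at this
    linarith
  have h1 : (u - v) ^ 2 ≤ (|u| + |v|) ^ 2 := by
    rw [← sq_abs (u - v)]
    exact pow_le_pow_left₀ (abs_nonneg _) (abs_sub _ _) 2
  have h2 : |(excess κ ξ u - excess κ ξ v) * (u - v)| ≤ A * (4 * (K * (1 / r))) := by
    rw [abs_mul]
    calc _ ≤ (A * |u| + A * |v|) * (|u| + |v|) :=
          mul_le_mul ((abs_sub _ _).trans (add_le_add heu hev)) (abs_sub _ _) (abs_nonneg _)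
            (by positivity)
      _ = A * (|u| + |v|) ^ 2 := by ring
      _ ≤ _ := mul_le_mul_of_nonneg_left huv hA0
  have h4 : A * (4 * (K * (1 / r))) =
      4 * K * κ ^ 2 * (-ξ * r + logScale κ * K) * (1 / r ^ 2) := by
    rw [hA]
    field_simp
  have h3 : 4 * K * κ ^ 2 * (-ξ * r + logScale κ * K) * (1 / r ^ 2) ≤
      4 * K * κ ^ 2 * (-ξ * R + logScale κ * K) * (1 / r ^ 2) := by
    gcongr
  have h5 := mul_le_mul_of_nonneg_left (h1.trans huv) (show 0 ≤ 1 / r by positivity)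
  have h6 : 1 / r * (4 * (K * (1 / r))) = 4 * K * (1 / r ^ 2) := by ring
  have h7 : (4 * K + 2 * K * κ ^ 2 * (-ξ * R + logScale κ * K)) * (1 / r ^ 2) =
    4 * K * (1 / r ^ 2) + 1 / 2 * (4 * K * κ ^ 2 * (-ξ * R + logScale κ * K) * (1 / r ^ 2)) := by
    ring
  rw [h7]
  linarith

/-- Inside a ball, all terms are dominated by a multiple of the integrable function `1 / |x|²`. -/
theorem tendsto_integral_localDefect {κ ξ : ℝ} (hκ : 0 < κ) (hξ : ξ ≤ 0) (R : ℝ)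
    {Ψ : ℕ → H1} (hΨ : ∀ j, Ψ j ∈ H1rad) {M : ℝ} (hM : ∀ j, ‖(Ψ j).1.snd‖ ^ 2 ≤ M)
    (hlim : ∀ᵐ x, ∃ l, Tendsto (fun k => fn (Ψ k) x) atTop (𝓝 l)) :
    Tendsto (fun p : ℕ × ℕ => ∫ x, localDefect κ ξ R (Ψ p.1) (Ψ p.2) x) atTop (𝓝 0) := by
  have hγ := sphereArea_pos
  have hc := logScale_pos hκ
  have hM0 : 0 ≤ M := (sq_nonneg _).trans (hM 0)
  have hξ' : 0 ≤ -ξ := by linarith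
  set K := M / sphereArea with hKdef
  have hK : 0 ≤ K := by positivity
  have hdec : ∀ᵐ x : R3, ∀ j, fn (Ψ j) x ^ 2 ≤ K * (1 / ‖x‖) := by
    refine ae_all_iff.2 fun j => ?_
    filter_upwards [sq_fn_le_of_radial (hΨ j)] with x hx
    refine hx.trans (mul_le_mul_of_nonneg_right ?_ (by positivity))
    rw [hKdef]
    gcongr
    exact hM j
  have hzero : ∫ _ : R3, (0 : ℝ) = 0 := by simp
  rw [← prod_atTop_atTop_eq, ← hzero]
  refine tendsto_integral_filter_of_dominated_convergence
    (fun x => (4 * K + 2 * K * κ ^ 2 * (-ξ * R + logScale κ * K)) *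
      (Metric.ball (0 : R3) R).indicator (fun x => 1 / ‖x‖ ^ 2) x)
    (Eventually.of_forall fun p => (integrable_localDefect hκ hξ R (hΨ _) (hΨ _)).1)
    (Eventually.of_forall fun p => ?_) ((integrable_indicator_inv_sq R).const_mul _) ?_
  · filter_upwards [hdec, ae_ne_zero_R3] with x hx hx0
    have hr := norm_pos_iff.2 hx0
    unfold localDefect
    by_cases hxR : x ∈ Metric.ball (0 : R3) R
    · rw [Set.indicator_of_mem hxR, Set.indicator_of_mem hxR, Real.norm_of_nonneg (by positivity)]
      have hrR : ‖x‖ < R := by simpa using hxR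
      exact defect_le hκ hξ hK hr hrR.le (hx p.1) (hx p.2)
    · rw [Set.indicator_of_notMem hxR, Set.indicator_of_notMem hxR]
      simp
  · filter_upwards [hdec, hlim] with x hx hl
    obtain ⟨l, hl⟩ := hl
    have hd : Tendsto (fun p : ℕ × ℕ => fn (Ψ p.1) x - fn (Ψ p.2) x) (atTop ×ˢ atTop) (𝓝 0) := by
      simpa using (hl.comp tendsto_fst).sub (hl.comp tendsto_snd)
    unfold localDefect
    by_cases hxR : x ∈ Metric.ball (0 : R3) R
    · simp only [Set.indicator_of_mem hxR]
      set s := K * (1 / ‖x‖)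
      have hs0 : 0 ≤ s := by positivity
      set A := κ ^ 2 * (-ξ + logScale κ * s)
      have hA0 : 0 ≤ A := by positivity
      have hb : ∀ j, |excess κ ξ (fn (Ψ j) x)| ≤ A * (1 + s) := fun j => by
        refine (abs_excess_le hκ hξ (hx j)).trans (mul_le_mul_of_nonneg_left ?_ hA0)
        have := hx j
        nlinarith [sq_abs (fn (Ψ j) x), sq_nonneg (|fn (Ψ j) x| - 1)]
      have hbound : Tendsto (fun p : ℕ × ℕ => 1 / ‖x‖ * (fn (Ψ p.1) x - fn (Ψ p.2) x) ^ 2 +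
          1 / 2 * (2 * (A * (1 + s)) * |fn (Ψ p.1) x - fn (Ψ p.2) x|))
          (atTop ×ˢ atTop) (𝓝 0) := by
        simpa using ((hd.pow 2).const_mul (1 / ‖x‖)).add
          ((hd.abs.const_mul (2 * (A * (1 + s)))).const_mul (1 / 2 : ℝ))
      refine squeeze_zero (fun p => by positivity) (fun p => ?_) hbound
      rw [abs_mul]
      gcongr
      refine (abs_sub _ _).trans ?_
      linarith [hb p.1, hb p.2]
    · simp only [Set.indicator_of_notMem hxR]
      exact tendsto_const_nhds

/-! ### The Palais–Smale condition -/

theorem norm_fst_of_mem_XiRad {Ψ : H1} (hΨ : Ψ ∈ XiRad) : ‖Ψ.1.fst‖ ^ 2 = 1 := by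
  have h := hΨ.2
  simp only [sq_abs] at h
  rwa [integral_sq_fn] at h

theorem norm_fst_eq_one {Ψ : H1} (hΨ : Ψ ∈ XiRad) : ‖Ψ.1.fst‖ = 1 :=
  (pow_eq_one_iff_of_nonneg (norm_nonneg _) two_ne_zero).1 (norm_fst_of_mem_XiRad hΨ)

theorem residual_self_eq (κ ξ ω : ℝ) {Ψ : H1} (hΨ : Ψ ∈ XiRad) :
    residual κ ξ ω Ψ Ψ = ω - energyZero Ψ - 1 / 2 * ∫ x, g κ ξ (fn Ψ x) * fn Ψ x := by
  have h1 : ∫ x, 1 / ‖x‖ * fn Ψ x * fn Ψ x = ∫ x, 1 / ‖x‖ * fn Ψ x ^ 2 := by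
    simp only [sq, mul_assoc]
  have h2 : ∫ x, fn Ψ x * fn Ψ x = 1 := by
    rw [← norm_fst_of_mem_XiRad hΨ, ← integral_sq_fn]
    simp only [sq]
  have h3 : ∫ x, inner ℝ (grad Ψ x) (grad Ψ x) = ‖Ψ.1.snd‖ ^ 2 := by
    rw [integral_inner_grad, real_inner_self_eq_norm_sq]
  rw [energyZero_eq hΨ.1, residual, h1, h2, h3]
  ring

/-- Concavity of `G` bounds the multiplier by the energy. -/
theorem multiplier_le {κ ξ : ℝ} (hκ : 0 < κ) (hξ : ξ ≤ 0) (ω : ℝ) {Ψ : H1} (hΨ : Ψ ∈ XiRad) :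
    ω ≤ energy κ ξ Ψ + residual κ ξ ω Ψ Ψ := by
  have h1 := residual_self_eq κ ξ ω hΨ
  have h2 := integral_g_mul_self_le hκ hξ hΨ.1
  rw [energy]
  linarith

/-- A kinetic energy bound keeps the multipliers bounded below. -/
theorem exists_le_multiplier {κ ξ : ℝ} (hκ : 0 < κ) (hξ : ξ ≤ 0) (M : ℝ) :
    ∃ B : ℝ, ∀ (ω : ℝ), ∀ Ψ ∈ XiRad, ‖Ψ.1.snd‖ ^ 2 ≤ M →
      B + residual κ ξ ω Ψ Ψ ≤ ω := by
  have hγ := sphereArea_pos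
  have hc := logScale_pos hκ
  refine ⟨-((1 + κ ^ 2 / 2) * (M + 1) + κ ^ 2 / 2 *
    (3 + Real.log (1 + logScale κ * (M / sphereArea)))), fun ω Ψ hΨ hT => ?_⟩
  have h1 := residual_self_eq κ ξ ω hΨ
  have h2 := le_integral_g_mul_self hκ hξ hΨ.1
  have h3 := integral_coulomb_le hΨ.1 one_pos
  rw [energyZero_eq hΨ.1] at h1
  rw [norm_fst_of_mem_XiRad hΨ] at h2 h3
  have h4 : Real.log (1 + logScale κ * (‖Ψ.1.snd‖ ^ 2 / sphereArea)) ≤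
      Real.log (1 + logScale κ * (M / sphereArea)) := by
    refine Real.log_le_log (by positivity) ?_
    gcongr
  have h5 := mul_le_mul_of_nonneg_left h4 (show 0 ≤ κ ^ 2 / 2 by positivity)
  have h6 : ∫ x, 1 / ‖x‖ * fn Ψ x ^ 2 ≤ M + 1 := by linarith
  have h7 := mul_le_mul_of_nonneg_left h6 (show 0 ≤ 1 + κ ^ 2 / 2 by positivity)
  nlinarith [sq_nonneg ‖Ψ.1.snd‖]

theorem exists_bound_of_tendsto_zero {E : Type*} [NormedAddCommGroup E] [NormedSpace ℝ E]
    {f : ℕ → StrongDual ℝ E} (hf : Tendsto f atTop (𝓝 0)) :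
    ∃ ε : ℕ → ℝ, Tendsto ε atTop (𝓝 0) ∧ ∀ j, 0 ≤ ε j ∧ ∀ x, |f j x| ≤ ε j * ‖x‖ :=
  ⟨fun j => ‖f j‖, tendsto_zero_iff_norm_tendsto_zero.1 hf,
    fun j => ⟨norm_nonneg _, fun x => (f j).le_opNorm x⟩⟩

/-- Convergence to zero in `H⁻¹`, expressed by explicit bounds on the values of the functionals. -/
theorem TendstoZeroHMinusOne.exists_bound {T : ℕ → H1 → ℝ} (h : TendstoZeroHMinusOne T) :
    ∃ ε : ℕ → ℝ, Tendsto ε atTop (𝓝 0) ∧ ∀ j, 0 ≤ ε j ∧ ∀ φ, |T j φ| ≤ ε j * ‖φ‖ := by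
  obtain ⟨f, hf, hf0⟩ := h
  obtain ⟨ε, hε, hεb⟩ := exists_bound_of_tendsto_zero hf0
  exact ⟨ε, hε, fun j => ⟨(hεb j).1, fun φ => hf j φ ▸ (hεb j).2 φ⟩⟩

theorem norm_le_of_mem_XiRad {Ψ : H1} (hΨ : Ψ ∈ XiRad) {M : ℝ} (hM : ‖Ψ.1.snd‖ ^ 2 ≤ M) :
    ‖Ψ‖ ≤ √(1 + M) := by
  refine Real.le_sqrt_of_sq_le ?_
  rw [H1.norm_sq_eq, norm_fst_of_mem_XiRad hΨ]
  linarith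

/-- A spectral gap `m` at infinity controls the distance of two approximate solutions by their
residuals, the difference of their multipliers, and the compact local defect. -/
theorem sq_norm_sub_le {κ ξ : ℝ} (hκ : 0 < κ) (hξ : ξ ≤ 0) {Ψ Φ : H1} (hΨ : Ψ ∈ XiRad)
    (hΦ : Φ ∈ XiRad) {M R m ω ω' : ℝ} (hMΨ : ‖Ψ.1.snd‖ ^ 2 ≤ M) (hMΦ : ‖Φ.1.snd‖ ^ 2 ≤ M)
    (hR : 0 < R) (hRM : logScale κ * (M / sphereArea * (1 / R)) ≤ Real.exp ξ) (hm : 0 < m)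
    (hgap : m ≤ 1 / 2 * Gprime κ ξ 0 - ω - 1 / R) {ε ε' : ℝ} (hε : 0 ≤ ε)
    (hε' : 0 ≤ ε') (hf : ∀ φ, |residual κ ξ ω Ψ φ| ≤ ε * ‖φ‖)
    (hf' : ∀ φ, |residual κ ξ ω' Φ φ| ≤ ε' * ‖φ‖) :
    ‖Ψ - Φ‖ ^ 2 ≤ (1 / m + 2) * ((ε' + ε) * (2 * √(1 + M)) + |ω - ω'| * 2 +
      ∫ x, localDefect κ ξ R Ψ Φ x) := by
  have hmain := norm_sub_le_residual_sub hκ hξ hΨ.1 hΦ.1 ω ω' hR hMΨ hMΦ hRM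
  have hd : ‖Ψ - Φ‖ ≤ 2 * √(1 + M) :=
    (norm_sub_le _ _).trans (by
      linarith [norm_le_of_mem_XiRad hΨ hMΨ, norm_le_of_mem_XiRad hΦ hMΦ])
  have hd1 : ‖(Ψ - Φ).1.fst‖ ≤ 2 :=
    (norm_sub_le Ψ.1.fst Φ.1.fst).trans
      ((add_le_add (norm_fst_eq_one hΨ).le (norm_fst_eq_one hΦ).le).trans_eq one_add_one_eq_two)
  have hin : (ω - ω') * inner ℝ Φ.1.fst (Ψ - Φ).1.fst ≤ |ω - ω'| * 2 := by
    refine (le_abs_self _).trans ?_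
    rw [abs_mul]
    refine mul_le_mul_of_nonneg_left ((abs_real_inner_le_norm _ _).trans ?_) (abs_nonneg _)
    exact (mul_le_mul (norm_fst_eq_one hΦ).le hd1 (norm_nonneg _) zero_le_one).trans_eq
      (one_mul 2)
  have h1 := (abs_le.1 ((hf (Ψ - Φ)).trans (mul_le_mul_of_nonneg_left hd hε))).1
  have h2 := (abs_le.1 ((hf' (Ψ - Φ)).trans (mul_le_mul_of_nonneg_left hd hε'))).2
  have hsq := H1.norm_sq_eq (Ψ - Φ)
  obtain ⟨E, hE⟩ : ∃ E, E = (ε' + ε) * (2 * √(1 + M)) + |ω - ω'| * 2 +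
    ∫ x, localDefect κ ξ R Ψ Φ x := ⟨_, rfl⟩
  rw [← hE]
  have ha : 0 ≤ ‖(Ψ - Φ).1.fst‖ ^ 2 := sq_nonneg _
  have hb : 0 ≤ ‖(Ψ - Φ).1.snd‖ ^ 2 := sq_nonneg _
  have h3 := mul_le_mul_of_nonneg_right hgap ha
  have h4 : m * ‖(Ψ - Φ).1.fst‖ ^ 2 + 1 / 2 * ‖(Ψ - Φ).1.snd‖ ^ 2 ≤ E := by linarith
  have h5 : ‖(Ψ - Φ).1.fst‖ ^ 2 ≤ 1 / m * E := by
    rw [div_mul_eq_mul_div, le_div_iff₀ hm]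
    linarith
  have h6 : ‖(Ψ - Φ).1.snd‖ ^ 2 ≤ 2 * E := by
    have := mul_nonneg hm.le ha
    linarith
  exact hsq.trans_le ((add_le_add h5 h6).trans_eq (add_mul _ _ _).symm)

/-- The multipliers of an approximate critical sequence of energy at most `-β` accumulate at a
number `ω' ≤ -β`. -/
theorem exists_subseq_tendsto_multiplier {κ ξ β : ℝ} (hκ : 0 < κ) (hξ : ξ ≤ 0) {Ψ : ℕ → H1}
    (hΨ : ∀ j, Ψ j ∈ XiRad) (henergy : ∀ j, energy κ ξ (Ψ j) ≤ -β) {M : ℝ}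
    (hM : ∀ j, ‖(Ψ j).1.snd‖ ^ 2 ≤ M) {ω ε : ℕ → ℝ} (hε : Tendsto ε atTop (𝓝 0))
    (hf : ∀ j, 0 ≤ ε j ∧ ∀ φ, |residual κ ξ (ω j) (Ψ j) φ| ≤ ε j * ‖φ‖) :
    ∃ n : ℕ → ℕ, StrictMono n ∧ ∃ ω' ≤ -β, Tendsto (ω ∘ n) atTop (𝓝 ω') := by
  obtain ⟨B, hB⟩ := exists_le_multiplier hκ hξ M
  have hself : ∀ j, |residual κ ξ (ω j) (Ψ j) (Ψ j)| ≤ ε j * √(1 + M) := fun j =>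
    ((hf j).2 (Ψ j)).trans
      (mul_le_mul_of_nonneg_left (norm_le_of_mem_XiRad (hΨ j) (hM j)) (hf j).1)
  have hself0 : Tendsto (fun j => ε j * √(1 + M)) atTop (𝓝 0) := by
    simpa using hε.mul_const (√(1 + M))
  obtain ⟨D, hD⟩ := hself0.bddAbove_range
  have hωle : ∀ j, ω j ≤ -β + ε j * √(1 + M) := fun j => by
    have := multiplier_le hκ hξ (ω j) (hΨ j)
    linarith [henergy j, (abs_le.1 (hself j)).2]
  have hωmem : ∀ j, ω j ∈ Set.Icc (B - D) (-β + D) := fun j => by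
    have h1 : ε j * √(1 + M) ≤ D := hD ⟨j, rfl⟩
    exact ⟨by linarith [hB (ω j) _ (hΨ j) (hM j), (abs_le.1 (hself j)).1], by linarith [hωle j]⟩
  obtain ⟨ω', -, n, hn, hω⟩ := isCompact_Icc.tendsto_subseq hωmem
  refine ⟨n, hn, ω', ?_, hω⟩
  have h1 := (hself0.comp hn.tendsto_atTop).const_add (-β)
  rw [add_zero] at h1
  exact le_of_tendsto_of_tendsto' hω h1 fun j => hωle (n j)

/-- Almost everywhere convergence and convergence of the multipliers upgrade to strong
convergence by testing the difference of two residuals with the difference of the functions. -/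
theorem tendsto_sq_norm_sub_of_tendsto_ae {κ ξ β : ℝ} (hκ : 0 < κ) (hξ : ξ ≤ 0)
    (hsmall : κ ^ 2 * (ξ + 3) < 2 * β) {Ψ : ℕ → H1} (hΨ : ∀ j, Ψ j ∈ XiRad) {M : ℝ}
    (hM : ∀ j, ‖(Ψ j).1.snd‖ ^ 2 ≤ M) {ω ε : ℕ → ℝ}
    (hε : Tendsto ε atTop (𝓝 0))
    (hf : ∀ j, 0 ≤ ε j ∧ ∀ φ, |residual κ ξ (ω j) (Ψ j) φ| ≤ ε j * ‖φ‖) {ω' : ℝ}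
    (hω : Tendsto ω atTop (𝓝 ω')) (hω' : ω' ≤ -β)
    (hae : ∀ᵐ x, ∃ l, Tendsto (fun k => fn (Ψ k) x) atTop (𝓝 l)) :
    Tendsto (fun p : ℕ × ℕ => ‖Ψ p.1 - Ψ p.2‖ ^ 2) atTop (𝓝 0) := by
  set m := β - κ ^ 2 * (ξ + 3) / 2 with hm
  have hm0 : 0 < m := by linarith
  -- `R` is so large that outside the ball of radius `R` the nonlinearity is linear and the
  -- Coulomb potential uses up at most a quarter of the spectral gap `m`
  set R := max (4 / m) (logScale κ * (M / sphereArea) / Real.exp ξ) with hRdef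
  have hR : 0 < R := lt_max_of_lt_left (by positivity)
  have hRm : 1 / R ≤ m / 4 := by
    rw [div_le_iff₀ hR]
    have := mul_le_mul_of_nonneg_left (le_max_left (4 / m)
      (logScale κ * (M / sphereArea) / Real.exp ξ)) (show 0 ≤ m / 4 by positivity)
    rw [← hRdef] at this
    have h1 : m / 4 * (4 / m) = 1 := by field_simp
    linarith
  have hRM : logScale κ * (M / sphereArea * (1 / R)) ≤ Real.exp ξ := by
    have h1 := le_max_right (4 / m) (logScale κ * (M / sphereArea) / Real.exp ξ)
    rw [← hRdef, div_le_iff₀ (Real.exp_pos ξ)] at h1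
    have h2 : logScale κ * (M / sphereArea * (1 / R)) = logScale κ * (M / sphereArea) / R := by ring
    rw [h2, div_le_iff₀ hR]
    linarith
  have hrad : ∀ j, Ψ j ∈ H1rad := fun j => (hΨ j).1
  have hloc := tendsto_integral_localDefect hκ hξ R hrad hM hae
  have hfst : Tendsto (Prod.fst : ℕ × ℕ → ℕ) atTop atTop :=
    prod_atTop_atTop_eq (α := ℕ) (β := ℕ) ▸ tendsto_fst
  have hsnd : Tendsto (Prod.snd : ℕ × ℕ → ℕ) atTop atTop :=
    prod_atTop_atTop_eq (α := ℕ) (β := ℕ) ▸ tendsto_snd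
  have hE0 : Tendsto (fun p : ℕ × ℕ => (ε p.2 + ε p.1) * (2 * √(1 + M)) + |ω p.1 - ω p.2| * 2 +
      ∫ x, localDefect κ ξ R (Ψ p.1) (Ψ p.2) x) atTop (𝓝 0) := by
    have h1 := ((hε.comp hsnd).add (hε.comp hfst)).mul_const (2 * √(1 + M))
    have h2 := ((hω.comp hfst).sub (hω.comp hsnd)).abs.mul_const 2
    have h3 := (h1.add h2).add hloc
    simp only [add_zero, zero_mul, sub_self, abs_zero] at h3
    exact h3
  have hωev : ∀ᶠ p : ℕ × ℕ in atTop, ω p.1 ≤ -β + m / 4 := by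
    refine hfst.eventually ((hω.eventually (gt_mem_nhds ?_)).mono fun j => le_of_lt)
    linarith
  have hE1 := hE0.const_mul (1 / (m / 2) + 2)
  rw [mul_zero] at hE1
  refine squeeze_zero' (Eventually.of_forall fun p => sq_nonneg _) ?_ hE1
  filter_upwards [hωev] with p hp
  refine sq_norm_sub_le hκ hξ (hΨ p.1) (hΨ p.2) (hM p.1) (hM p.2) hR hRM (half_pos hm0) ?_
    (hf p.1).1 (hf p.2).1 (hf p.1).2 (hf p.2).2
  rw [Gprime_zero]
  linarith

theorem exists_subseq_tendsto_sq_norm_sub {κ ξ β : ℝ} (hκ : 0 < κ) (hξ : ξ ≤ 0) (hβ : 0 < β)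
    (hsmall : κ ^ 2 * (ξ + 3) < 2 * β) {Ψ : ℕ → H1} (hΨ : ∀ j, Ψ j ∈ XiRad)
    (henergy : ∀ j, energy κ ξ (Ψ j) ≤ -β) {ω : ℕ → ℝ}
    (hres : TendstoZeroHMinusOne fun j => residual κ ξ (ω j) (Ψ j)) :
    ∃ n : ℕ → ℕ, StrictMono n ∧
      Tendsto (fun p : ℕ × ℕ => ‖Ψ (n p.1) - Ψ (n p.2)‖ ^ 2) atTop (𝓝 0) := by
  obtain ⟨ε, hε, hf⟩ := hres.exists_bound
  obtain ⟨M, hM⟩ := exists_kinetic_bound hκ hξ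
  have hMj : ∀ j, ‖(Ψ j).1.snd‖ ^ 2 ≤ M := fun j =>
    hM _ (hΨ j) ((henergy j).trans (by linarith))
  obtain ⟨n₁, hn₁, ω', hω', hω⟩ := exists_subseq_tendsto_multiplier hκ hξ hΨ henergy hMj hε hf
  obtain ⟨n₂, hn₂, hae⟩ := exists_subseq_tendsto_ae (Ψ := fun k => Ψ (n₁ k))
    (fun k => (hΨ _).1) (fun k => hMj _)
  have hlim := tendsto_sq_norm_sub_of_tendsto_ae (Ψ := fun k => Ψ (n₁ (n₂ k)))
    (ω := fun k => ω (n₁ (n₂ k))) (ε := fun k => ε (n₁ (n₂ k))) hκ hξ hsmall (fun k => hΨ _)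
    (fun k => hMj _) (hε.comp (hn₁.comp hn₂).tendsto_atTop) (fun k => hf _)
    (hω.comp hn₂.tendsto_atTop) hω' hae
  exact ⟨fun k => n₁ (n₂ k), hn₁.comp hn₂, hlim⟩

end CoulombLog

end

theorem mainTheorem9 (κ ξ β : ℝ) (hκ : 0 < κ) (hξ : ξ ≤ 0) (hβ : 0 < β)
    (hsmall : κ ^ 2 * (ξ + 3) < 2 * β)
    (Ψ : ℕ → CoulombLog.H1) (hΨ : ∀ j, Ψ j ∈ CoulombLog.XiRad)
    (henergy : ∀ j, CoulombLog.energy κ ξ (Ψ j) ≤ -β)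
    (ω : ℕ → ℝ)
    (hres : CoulombLog.TendstoZeroHMinusOne
      (fun j => CoulombLog.residual κ ξ (ω j) (Ψ j))) :
    ∃ n : ℕ → ℕ, StrictMono n ∧ ∃ Ψlim ∈ CoulombLog.H1rad,
      Tendsto (fun k => Ψ (n k)) atTop (𝓝 Ψlim) := by
  obtain ⟨n, hn, hcauchy⟩ :=
    CoulombLog.exists_subseq_tendsto_sq_norm_sub hκ hξ hβ hsmall hΨ henergy hres
  exact ⟨n, hn, CoulombLog.exists_mem_tendsto_of_tendsto_sq_norm_sub CoulombLog.isClosed_H1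
    CoulombLog.isClosed_H1rad (fun k => (hΨ (n k)).1) hcauchy⟩
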